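/- **Nonconfluence of minimal reduction.** Work over the signature with a constant $0$, a unary function symbol $s$ and a unary predicate symbol $\mathsf{iszero}$, and the theory $\mathcal T$ with the single universal axiom $\neg\mathsf{iszero}(s(x))$. *Herbrand nets.* Expansion trees are $p ::= S \mid \alpha[a].p \mid (w+\dots+w)$, where $S$ is a nonempty finite set of tautology indices, $a$ is a variable and the sum is a nonempty, commutative formal sum of witnesses $w ::= \varepsilon[M].p$ with $M$ a first-order term. They are typed by prenex formulae in negation normal form: $S:P$ for every quantifier-free $P$; $\alpha[a].t:\forall x.A$ if $t:A[x:=a]$; $(\varepsilon[M_1].t_1+\dots+\varepsilon[M_n].t_n):\exists x.A$ if $t_i:A[x:=M_i]$ for all $i$. A cut $t\bowtie s:A\bowtie\bar A$ (unordered) consists of $t:A$ and $s:\bar A$. An annotated sequent is a finite multiset $F$ of typed expansion trees and cuts in which distinct $\alpha$'s carry distinct variables (eigenvariables) and no eigenvariable is free in the type of a non-cut root; its type is the multiset of types of its non-cut roots. Its dependency graph has as vertices the occurrences of subterms (nodes) and the indices occurring in $F$, and as edges: child $\to$ parent; $\varepsilon[M]\to\alpha[a]$ if $a$ is free in $M$;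 a cut of type $A\bowtie\bar A$ $\to\alpha[a]$ if $a$ is free in $A$; index $i\to S$ if $i\in S$. A switching selects one incoming edge for each $\alpha$-node, sum and set $S$; $F$ is ACC if, for each switching, deleting the other incoming edges of those nodes and forgetting directions leaves a connected acyclic graph (two opposite edges count as a cycle). $F$ is a *Herbrand net* if it is ACC and, for each index $i$ of $F$, $\mathcal T$ entails the disjunction of the types of the sets $S\ni i$ in $F$. A subnet is a set of nodes that is closed under dependency (if it contains $y$ and there is a directed path from the node $x$ to $y$, it contains $x$) and whose part of the dependency graph is ACC; the kingdom $k(X)$ of a node $X$ is the least subnet that contains $X$ but not its parent. *Minimal reduction* is generated by the following steps on Herbrand nets. - Prop: $F,\ \{i\}\bowtie\{j\}\ \leadsto\ F[i:=j]$. - Comm: $F,\ \alpha[a].t\bowtie(\varepsilon[M].u):\forall x.A\bowtie\exists x.\bar A\ \leadsto\ F[a:=M],\ (t\bowtie u)[a:=M] : A[x:=M]\bowtie\bar A[x:=M]$. - Dup: $F,\ \alpha[x].t\bowtie(s_0+s_1)\ \leadsto\ D(F),\ \alpha[x_0].\tau_0(t)\bowtie s_0,\ \alpha[x_1].\tau_1(t)\bowtie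 s_1$. Here $K$ is the kingdom of the node $\alpha[x]$, the renamings $\tau_0,\tau_1$ give two disjoint families of fresh names to the eigenvariables and indices occurring in $K$, $x_k=\tau_k(x)$, and $D$ replaces every witness that lies in $K$ but is a summand of a sum outside $K$ by the sum of its two renamed copies, every cut in $K$ by its two renamed copies, and every index $i$ of $K$ in a set $S$ outside $K$ by $\tau_0(i),\tau_1(i)$. **Theorem.** Let $A=\exists x.\forall y.(\neg\mathsf{iszero}(x)\vee\mathsf{iszero}(s(y)))$, and let $N$ be the annotated sequent with roots $$(\varepsilon[0].\alpha[a].\{1\}+\varepsilon[s(a)].\alpha[b].\{1\})\bowtie\alpha[g].(\varepsilon[h].\{2\}) : A\bowtie\bar A,$$ $$\alpha[h].(\varepsilon[g].\{2\})\bowtie(\varepsilon[0].\alpha[d].\{3\}+\varepsilon[s(d)].\alpha[e].\{3\}) : \bar A\bowtie A,$$ $$(\varepsilon[h].\{2\}) : \exists z.\neg\mathsf{iszero}(s(z)).$$ Then $N$ is a Herbrand net of type $\exists z.\neg\mathsf{iszero}(s(z))$, and it reduces by minimal reduction both to a cut-free Herbrand net $$N_3=(\varepsilon[0].\{i\}+\varepsilon[s0].\{i\}+\varepsilon[ss0].\{i\}):\exists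 z.\neg\mathsf{iszero}(s(z))$$ and to a cut-free Herbrand net $$N_4=(\varepsilon[0].\{j\}+\varepsilon[s0].\{j\}+\varepsilon[ss0].\{j\}+\varepsilon[sss0].\{j\}):\exists z.\neg\mathsf{iszero}(s(z)),$$ for some indices $i,j$. The nets $N_3$ and $N_4$ are different, even up to renaming of eigenvariables and indices. Hence minimal reduction on Herbrand nets over $\mathcal T$ is not confluent, even up to such renaming. -/

import Mathlib

/-!
Herbrand nets over the signature with a constant `0`, a unary function symbol `s` and a unary
predicate symbol `iszero`, and their cut-reduction by "minimal reduction".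

Variable symbols and tautology indices are natural numbers.
-/

namespace HerbrandNet

/-! ### First-order terms and prenex formulae -/

/-- Terms over the signature `{0, s}`.  `fvar x` is the variable symbol `x`; `bvar k` refers to the
`k`-th enclosing quantifier, counted from the outside.  The first-order terms of the signature are
the elements of `Tm 0`; the elements of `Tm n` occur under `n` quantifiers. -/
inductive Tm (n : ℕ) : Type
  | fvar (x : ℕ) : Tm n
  | bvar (k : Fin n) : Tm n
  | zero : Tm n
  | succ (t : Tm n) : Tm n
  deriving DecidableEq

/-- The free variables of a term. -/
def Tm.free {n : ℕ} : Tm n → Finset ℕ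
  | .fvar x => {x}
  | .bvar _ => ∅
  | .zero => ∅
  | .succ t => t.free

/-- A first-order term placed under `n` quantifiers. -/
def Tm.lift {n : ℕ} : Tm 0 → Tm n
  | .fvar x => .fvar x
  | .bvar k => k.elim0
  | .zero => .zero
  | .succ t => .succ t.lift

/-- Simultaneous substitution of first-order terms for the variable symbols. -/
def Tm.subst {n : ℕ} (f : ℕ → Tm 0) : Tm n → Tm n
  | .fvar x => (f x).lift
  | .bvar k => .bvar k
  | .zero => .zero
  | .succ t => .succ (t.subst f)

/-- Instantiation of the outermost quantified variable by `M`. -/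
def Tm.inst {n : ℕ} : Tm (n + 1) → Tm 0 → Tm n
  | .fvar x, _ => .fvar x
  | .bvar k, M => Fin.cases M.lift .bvar k
  | .zero, _ => .zero
  | .succ t, M => .succ (t.inst M)

/-- Quantifier-free formulae in negation normal form. -/
inductive QF (n : ℕ) : Type
  | iszero (t : Tm n) : QF n
  | nonzero (t : Tm n) : QF n
  | and (P Q : QF n) : QF n
  | or (P Q : QF n) : QF n
  deriving DecidableEq

def QF.free {n : ℕ} : QF n → Finset ℕ
  | .iszero t => t.free
  | .nonzero t => t.free
  | .and P Q => P.free ∪ Q.free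
  | .or P Q => P.free ∪ Q.free

def QF.subst {n : ℕ} (f : ℕ → Tm 0) : QF n → QF n
  | .iszero t => .iszero (t.subst f)
  | .nonzero t => .nonzero (t.subst f)
  | .and P Q => .and (P.subst f) (Q.subst f)
  | .or P Q => .or (P.subst f) (Q.subst f)

def QF.inst {n : ℕ} (M : Tm 0) : QF (n + 1) → QF n
  | .iszero t => .iszero (t.inst M)
  | .nonzero t => .nonzero (t.inst M)
  | .and P Q => .and (P.inst M) (Q.inst M)
  | .or P Q => .or (P.inst M) (Q.inst M)

/-- The De Morgan dual. -/
def QF.dual {n : ℕ} : QF n → QF n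
  | .iszero t => .nonzero t
  | .nonzero t => .iszero t
  | .and P Q => .or P.dual Q.dual
  | .or P Q => .and P.dual Q.dual

/-- Prenex formulae (up to renaming of bound variables); the prenex formulae proper are the elements
of `Prenex 0`. -/
inductive Prenex : ℕ → Type
  | qf {n : ℕ} (P : QF n) : Prenex n
  | all {n : ℕ} (A : Prenex (n + 1)) : Prenex n
  | ex {n : ℕ} (A : Prenex (n + 1)) : Prenex n

def Prenex.free : {n : ℕ} → Prenex n → Finset ℕ
  | _, .qf P => P.free
  | _, .all A => A.free
  | _, .ex A => A.free

/-- Capture-avoiding simultaneous substitution for the free variables. -/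
def Prenex.subst (f : ℕ → Tm 0) : {n : ℕ} → Prenex n → Prenex n
  | _, .qf P => .qf (P.subst f)
  | _, .all A => .all (A.subst f)
  | _, .ex A => .ex (A.subst f)

def Prenex.instAux (M : Tm 0) : {m : ℕ} → Prenex m → (n : ℕ) → m = n + 1 → Prenex n
  | _, .qf P, _, h => .qf ((h ▸ P).inst M)
  | _, .all A, n, h => .all (A.instAux M (n + 1) (congrArg (· + 1) h))
  | _, .ex A, n, h => .ex (A.instAux M (n + 1) (congrArg (· + 1) h))

/-- For a quantified formula `qx.A`, the formula `A[x := M]` is `A.inst M`. -/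
def Prenex.inst (M : Tm 0) {n : ℕ} (A : Prenex (n + 1)) : Prenex n := A.instAux M n rfl

@[simp] theorem Prenex.inst_qf (M : Tm 0) {n : ℕ} (P : QF (n + 1)) :
    (Prenex.qf P).inst M = .qf (P.inst M) := rfl

@[simp] theorem Prenex.inst_all (M : Tm 0) {n : ℕ} (A : Prenex (n + 2)) :
    (Prenex.all A).inst M = .all (A.inst M) := rfl

@[simp] theorem Prenex.inst_ex (M : Tm 0) {n : ℕ} (A : Prenex (n + 2)) :
    (Prenex.ex A).inst M = .ex (A.inst M) := rfl

def Prenex.dual : {n : ℕ} → Prenex n → Prenex n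
  | _, .qf P => .qf P.dual
  | _, .all A => .ex A.dual
  | _, .ex A => .all A.dual

/-! ### Semantics -/

/-- First-order structures for the signature, with domain `D`. -/
structure Struc (D : Type) where
  zero : D
  succ : D → D
  iszero : D → Prop

def Tm.eval {D : Type} (S : Struc D) (v : ℕ → D) : Tm 0 → D
  | .fvar x => v x
  | .bvar k => k.elim0
  | .zero => S.zero
  | .succ t => S.succ (t.eval S v)

def QF.Holds {D : Type} (S : Struc D) (v : ℕ → D) : QF 0 → Prop
  | .iszero t => S.iszero (t.eval S v)
  | .nonzero t => ¬ S.iszero (t.eval S v)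
  | .and P Q => P.Holds S v ∧ Q.Holds S v
  | .or P Q => P.Holds S v ∨ Q.Holds S v

/-- `T ⊨ ⋁ Γ`, where the open formulae in `T` are read as universal axioms. -/
def Entails (T : Set (QF 0)) (Γ : Set (QF 0)) : Prop :=
  ∀ (D : Type) (S : Struc D), (∀ P ∈ T, ∀ v : ℕ → D, P.Holds S v) →
    ∀ v : ℕ → D, ∃ P ∈ Γ, P.Holds S v

/-! ### Expansion trees, cuts and forests -/

mutual
/-- Expansion trees: sets of indices `S`, `α[a].t`, and formal sums `(w₁ + ⋯ + wₙ)`. -/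
inductive Tree : Type
  | leaf (S : Finset ℕ) : Tree
  | alpha (a : ℕ) (t : Tree) : Tree
  | sum (ws : Wits) : Tree
/-- Lists of witnessing terms; `cons M t ws` is `ε[M].t + ws`. -/
inductive Wits : Type
  | nil : Wits
  | cons (M : Tm 0) (t : Tree) (ws : Wits) : Wits
end

def Wits.append : Wits → Wits → Wits
  | .nil, vs => vs
  | .cons M t ws, vs => .cons M t (ws.append vs)

/-- The roots of a forest without naked witnesses: `tree t A` is a non-cut root `t : A`, and
`cut t s A` is a cut `t ⋈ s : A ⋈ Ā`. -/
inductive Root : Type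
  | tree (t : Tree) (A : Prenex 0) : Root
  | cut (t s : Tree) (A : Prenex 0) : Root

abbrev Forest := List Root

mutual
/-- The typing judgement `t : A`. -/
def Tree.HasType : Tree → Prenex 0 → Prop
  | .leaf S, .qf _ => S.Nonempty
  | .alpha a t, .all A => t.HasType (A.inst (.fvar a))
  | .sum ws, .ex A => ws ≠ .nil ∧ ws.HasType A
  | _, _ => False
/-- All summands have witness type `⟨∃x.A⟩`. -/
def Wits.HasType : Wits → Prenex 1 → Prop
  | .nil, _ => True
  | .cons M t ws, A => t.HasType (A.inst M) ∧ ws.HasType A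
end

def Root.Typed : Root → Prop
  | .tree t A => t.HasType A
  | .cut t s A => t.HasType A ∧ s.HasType A.dual

mutual
/-- The propositional nodes of a typed tree, with their types. -/
def Tree.leaves : Tree → Prenex 0 → List (Finset ℕ × QF 0)
  | .leaf S, .qf P => [(S, P)]
  | .alpha a t, .all A => t.leaves (A.inst (.fvar a))
  | .sum ws, .ex A => ws.leaves A
  | _, _ => []
def Wits.leaves : Wits → Prenex 1 → List (Finset ℕ × QF 0)
  | .nil, _ => []
  | .cons M t ws, A => t.leaves (A.inst M) ++ ws.leaves A
end

def Root.leaves : Root → List (Finset ℕ × QF 0)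
  | .tree t A => t.leaves A
  | .cut t s A => t.leaves A ++ s.leaves A.dual

/-- The type of a forest: the multiset of the types of its non-cut roots. -/
def Forest.type : Forest → Multiset (Prenex 0)
  | [] => 0
  | .tree _ A :: F => A ::ₘ Forest.type F
  | .cut _ _ _ :: F => Forest.type F

def Forest.CutFree (F : Forest) : Prop := ∀ t s A, Root.cut t s A ∉ F

/-! ### Nodes -/

/-- An occurrence of a subterm, as a path read from the node down to the root: the `r`-th root of a
forest is `[r]`, and the `i`-th child of the node `p` is `i :: p`. -/
abbrev Node := List ℕ

/-- The outermost constructor of a node; a cut carries the formula `A` of its type `A ⋈ Ā`. -/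
inductive Label : Type
  | leaf (S : Finset ℕ) : Label
  | alpha (a : ℕ) : Label
  | sum : Label
  | eps (M : Tm 0) : Label
  | cut (A : Prenex 0) : Label

mutual
/-- The nodes of a tree that is located at `p`. -/
def Tree.nodes (p : Node) : Tree → List (Node × Label)
  | .leaf S => [(p, .leaf S)]
  | .alpha a t => (p, .alpha a) :: t.nodes (0 :: p)
  | .sum ws => (p, .sum) :: ws.nodes p 0
/-- The nodes of the summands number `i`, `i + 1`, … of the expansion node `p`. -/
def Wits.nodes (p : Node) (i : ℕ) : Wits → List (Node × Label)
  | .nil => []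
  | .cons M t ws => (i :: p, .eps M) :: (t.nodes (0 :: i :: p) ++ ws.nodes p (i + 1))
end

def Root.nodes (r : ℕ) : Root → List (Node × Label)
  | .tree t _ => t.nodes [r]
  | .cut t s A => ([r], .cut A) :: (t.nodes [0, r] ++ s.nodes [1, r])

def Forest.nodesFrom (r : ℕ) : Forest → List (Node × Label)
  | [] => []
  | R :: F => R.nodes r ++ Forest.nodesFrom (r + 1) F

/-- The nodes of a forest, with their labels. -/
def Forest.nodes (F : Forest) : List (Node × Label) := Forest.nodesFrom 0 F

/-- `F.Has x l`: the forest `F` has a node `x` labelled `l`. -/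
def Forest.Has (F : Forest) (x : Node) (l : Label) : Prop := (x, l) ∈ Forest.nodes F

def Forest.nodeSet (F : Forest) : Finset Node := ((Forest.nodes F).map Prod.fst).toFinset

/-! ### Annotated sequents and Herbrand structures -/

/-- The eigenvariables of a forest, with repetitions. -/
def Forest.eigenvariables (F : Forest) : List ℕ :=
  (Forest.nodes F).filterMap fun x => match x.2 with
    | .alpha a => some a
    | _ => none

/-- The variable `a` occurs in `F`, as an eigenvariable, in a witness, or in a type. -/
def Forest.Occurs (F : Forest) (a : ℕ) : Prop :=
  a ∈ Forest.eigenvariables F ∨ (∃ x M, Forest.Has F x (.eps M) ∧ a ∈ M.free) ∨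
    (∃ t A, Root.tree t A ∈ F ∧ a ∈ A.free) ∨ (∃ t s A, Root.cut t s A ∈ F ∧ a ∈ A.free)

/-- The tautology index `i` occurs in `F`. -/
def Forest.HasIndex (F : Forest) (i : ℕ) : Prop := ∃ x S, Forest.Has F x (.leaf S) ∧ i ∈ S

/-- Strict typed forests without naked witnesses. -/
structure Forest.IsAnnotatedSequent (F : Forest) : Prop where
  typed : ∀ R ∈ F, R.Typed
  distinct : (Forest.eigenvariables F).Nodup
  strict : ∀ t A, Root.tree t A ∈ F → ∀ a ∈ Forest.eigenvariables F, a ∉ A.free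

/-- For each index `i` of `F`, `T ⊨ F_i`, where `F_i` is the disjunction of the types of the
propositional nodes in which `i` occurs. -/
def Forest.IsHerbrandStructure (T : Set (QF 0)) (F : Forest) : Prop :=
  ∀ i, Forest.HasIndex F i →
    Entails T {P | ∃ R ∈ F, ∃ S, (S, P) ∈ Root.leaves R ∧ i ∈ S}

/-! ### The dependency graph, switchings and nets -/

/-- Vertices of dependency graphs: nodes and tautology indices. -/
abbrev Vertex := Node ⊕ ℕ

/-- The edges of the dependency graph of `F`: the edges of the forest, from child to parent, and the
jumps. -/
inductive Forest.Dep (F : Forest) : Vertex → Vertex → Prop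
  | child (k : ℕ) (p : Node) (l l' : Label) :
      Forest.Has F (k :: p) l → Forest.Has F p l' → Forest.Dep F (.inl (k :: p)) (.inl p)
  | epsJump (x y : Node) (M : Tm 0) (a : ℕ) :
      Forest.Has F x (.eps M) → Forest.Has F y (.alpha a) → a ∈ M.free →
      Forest.Dep F (.inl x) (.inl y)
  | cutJump (x y : Node) (A : Prenex 0) (a : ℕ) :
      Forest.Has F x (.cut A) → Forest.Has F y (.alpha a) → a ∈ A.free →
      Forest.Dep F (.inl x) (.inl y)
  | index (i : ℕ) (x : Node) (S : Finset ℕ) :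
      Forest.Has F x (.leaf S) → i ∈ S → Forest.Dep F (.inr i) (.inl x)

/-- The switched nodes. -/
def Forest.Switched (F : Forest) (x : Node) : Prop :=
  (∃ a, Forest.Has F x (.alpha a)) ∨ Forest.Has F x .sum ∨ ∃ S, Forest.Has F x (.leaf S)

/-- The vertices of the dependency graph of the subforest of `F` on a set `G` of nodes. -/
def Forest.vertices (F : Forest) (G : Finset Node) : Set Vertex :=
  {u | (∃ x ∈ G, u = .inl x) ∨ ∃ x ∈ G, ∃ S, Forest.Has F x (.leaf S) ∧ ∃ i ∈ S, u = .inr i}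

/-- The edges of the dependency graph of the subforest of `F` on `G`. -/
def Forest.DepIn (F : Forest) (G : Finset Node) (u v : Vertex) : Prop :=
  Forest.Dep F u v ∧ u ∈ Forest.vertices F G ∧ v ∈ Forest.vertices F G

/-- A switching chooses an incoming edge for each switched node of `G`, given by its source; its
values at other nodes are irrelevant. -/
def Forest.IsSwitching (F : Forest) (G : Finset Node) (σ : Node → Vertex) : Prop :=
  ∀ x ∈ G, Forest.Switched F x → Forest.DepIn F G (σ x) (.inl x)

/-- The directed edges that are kept by the switching `σ`. -/
def Forest.SwitchEdge (F : Forest) (G : Finset Node) (σ : Node → Vertex) (u v : Vertex) : Prop :=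
  Forest.DepIn F G u v ∧ ∀ x, v = .inl x → Forest.Switched F x → u = σ x

/-- The switching graph, with parallel edges identified. -/
def Forest.switchingGraph (F : Forest) (G : Finset Node) (σ : Node → Vertex) :
    SimpleGraph (Forest.vertices F G) :=
  SimpleGraph.fromRel fun u v => Forest.SwitchEdge F G σ u v

/-- The subforest of `F` on `G` is ACC: each switching graph is connected and acyclic.  An edge
`u → v` together with an edge `v → u` counts as a cycle. -/
def Forest.ACCOn (F : Forest) (G : Finset Node) : Prop :=
  ∀ σ, Forest.IsSwitching F G σ → (Forest.switchingGraph F G σ).IsTree ∧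
    ∀ u v, Forest.SwitchEdge F G σ u v → ¬ Forest.SwitchEdge F G σ v u

structure Forest.IsHerbrandNet (T : Set (QF 0)) (F : Forest) : Prop where
  annotated : Forest.IsAnnotatedSequent F
  structural : Forest.IsHerbrandStructure T F
  acc : Forest.ACCOn F (Forest.nodeSet F)

/-! ### Subnets and kingdoms -/

/-- The dependency relation: the reflexive transitive closure of the edges of the dependency graph,
restricted to nodes. -/
def Forest.Depends (F : Forest) (x y : Node) : Prop :=
  Relation.ReflTransGen (Forest.Dep F) (.inl x) (.inl y)

structure Forest.IsSubnet (F : Forest) (G : Finset Node) : Prop where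
  subset : G ⊆ Forest.nodeSet F
  closed : ∀ x y, y ∈ G → Forest.Depends F x y → x ∈ G
  acc : Forest.ACCOn F G

/-- `K` is the kingdom of the node `x` in `F`: the smallest subnet that has `x` as a root. -/
def Forest.IsKingdom (F : Forest) (x : Node) (K : Finset Node) : Prop :=
  IsLeast {G : Finset Node | Forest.IsSubnet F G ∧ x ∈ G ∧ x.tail ∉ G} K

/-! ### Renaming and substitution -/

/-- A simultaneous renaming of variables and tautology indices. -/
structure Renaming where
  var : ℕ → ℕ
  idx : ℕ → ℕ

def Renaming.tm (τ : Renaming) (M : Tm 0) : Tm 0 := M.subst fun x => .fvar (τ.var x)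

def Renaming.formula (τ : Renaming) (A : Prenex 0) : Prenex 0 := A.subst fun x => .fvar (τ.var x)

mutual
def Tree.rename (τ : Renaming) : Tree → Tree
  | .leaf S => .leaf (S.image τ.idx)
  | .alpha a t => .alpha (τ.var a) (t.rename τ)
  | .sum ws => .sum (ws.rename τ)
def Wits.rename (τ : Renaming) : Wits → Wits
  | .nil => .nil
  | .cons M t ws => .cons (τ.tm M) (t.rename τ) (ws.rename τ)
end

def Root.rename (τ : Renaming) : Root → Root
  | .tree t A => .tree (t.rename τ) (τ.formula A)
  | .cut t s A => .cut (t.rename τ) (s.rename τ) (τ.formula A)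

def Forest.rename (τ : Renaming) (F : Forest) : Forest := List.map (Root.rename τ) F

/-- The renaming `[i ← j]` of a tautology index. -/
def Renaming.index (i j : ℕ) : Renaming := ⟨id, Function.update id i j⟩

/-- The substitution `[a := M]` on first-order terms and formulae. -/
def single (a : ℕ) (M : Tm 0) : ℕ → Tm 0 := fun x => if x = a then M else .fvar x

mutual
/-- The substitution `t[a := M]`; it is used where `a` is not an eigenvariable of `t`. -/
def Tree.subst (a : ℕ) (M : Tm 0) : Tree → Tree
  | .leaf S => .leaf S
  | .alpha d t => .alpha d (t.subst a M)
  | .sum ws => .sum (ws.subst a M)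
def Wits.subst (a : ℕ) (M : Tm 0) : Wits → Wits
  | .nil => .nil
  | .cons N t ws => .cons (N.subst (single a M)) (t.subst a M) (ws.subst a M)
end

def Root.subst (a : ℕ) (M : Tm 0) : Root → Root
  | .tree t A => .tree (t.subst a M) (A.subst (single a M))
  | .cut t s A => .cut (t.subst a M) (s.subst a M) (A.subst (single a M))

def Forest.subst (a : ℕ) (M : Tm 0) (F : Forest) : Forest := List.map (Root.subst a M) F

/-! ### Duplication of a kingdom -/

/-- The eigenvariables bound in the set `K` of nodes of `F`. -/
def Forest.boundIn (F : Forest) (K : Finset Node) : Set ℕ :=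
  {a | ∃ x ∈ K, Forest.Has F x (.alpha a)}

/-- The tautology indices that occur in `K`. -/
def Forest.indicesIn (F : Forest) (K : Finset Node) : Set ℕ :=
  {i | ∃ x ∈ K, ∃ S, Forest.Has F x (.leaf S) ∧ i ∈ S}

/-- `f₀` and `f₁` rename the elements of `V` injectively to names not in `used` (and with disjoint
images), and fix everything else. -/
structure FreshPair (used : ℕ → Prop) (V : Set ℕ) (f₀ f₁ : ℕ → ℕ) : Prop where
  fix₀ : ∀ a, a ∉ V → f₀ a = a
  fix₁ : ∀ a, a ∉ V → f₁ a = a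
  inj₀ : Set.InjOn f₀ V
  inj₁ : Set.InjOn f₁ V
  fresh₀ : ∀ a ∈ V, ¬ used (f₀ a)
  fresh₁ : ∀ a ∈ V, ¬ used (f₁ a)
  disjoint : ∀ a ∈ V, ∀ b ∈ V, f₀ a ≠ f₁ b

mutual
/-- The operation `D` that duplicates the part of a tree (located at `p`) that lies in `K`: an index
is replaced by its two copies, and a summand `ε[M].t` that lies in `K` by the sum of its two
copies. -/
def Tree.dup (K : Finset Node) (τ₀ τ₁ : Renaming) (p : Node) : Tree → Tree
  | .leaf S => .leaf (S.biUnion fun i => {τ₀.idx i, τ₁.idx i})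
  | .alpha a t => .alpha a (t.dup K τ₀ τ₁ (0 :: p))
  | .sum ws => .sum (ws.dup K τ₀ τ₁ p 0)
def Wits.dup (K : Finset Node) (τ₀ τ₁ : Renaming) (p : Node) (i : ℕ) : Wits → Wits
  | .nil => .nil
  | .cons M t ws =>
      if i :: p ∈ K then
        .cons (τ₀.tm M) (t.rename τ₀) (.cons (τ₁.tm M) (t.rename τ₁)
          (ws.dup K τ₀ τ₁ p (i + 1)))
      else
        .cons M (t.dup K τ₀ τ₁ (0 :: i :: p)) (ws.dup K τ₀ τ₁ p (i + 1))
end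

/-- `D` on the `r`-th root; a cut in `K` is replaced by its two copies. -/
def Root.dup (K : Finset Node) (τ₀ τ₁ : Renaming) (r : ℕ) : Root → List Root
  | .tree t A => [.tree (t.dup K τ₀ τ₁ [r]) A]
  | .cut t s A =>
      if [r] ∈ K then [(Root.cut t s A).rename τ₀, (Root.cut t s A).rename τ₁]
      else [.cut (t.dup K τ₀ τ₁ [0, r]) (s.dup K τ₀ τ₁ [1, r]) A]

/-- `D` on the list of roots number `r`, `r + 1`, …. -/
def Forest.dupFrom (K : Finset Node) (τ₀ τ₁ : Renaming) (r : ℕ) : Forest → Forest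
  | [] => []
  | R :: F => R.dup K τ₀ τ₁ r ++ Forest.dupFrom K τ₀ τ₁ (r + 1) F

/-! ### Minimal reduction -/

/-- The three reduction rules, applied to a cut that is written first.  In `dup`, `K` is the kingdom
of the node `α[x]`, which is the left child `[0, 0]` of the cut `[0]`. -/
inductive Forest.Rule : Forest → Forest → Prop
  | prop (i j : ℕ) (P : QF 0) (F : Forest) :
      Forest.Rule (.cut (.leaf {i}) (.leaf {j}) (.qf P) :: F)
        (Forest.rename (Renaming.index i j) F)
  | comm (a : ℕ) (t : Tree) (M : Tm 0) (s : Tree) (A : Prenex 1) (F : Forest) :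
      Forest.Rule (.cut (.alpha a t) (.sum (.cons M s .nil)) (.all A) :: F)
        (.cut (t.subst a M) (s.subst a M) (A.inst M) :: Forest.subst a M F)
  | dup (x : ℕ) (t : Tree) (s₀ s₁ : Wits) (A : Prenex 1) (F G : Forest)
      (K : Finset Node) (τ₀ τ₁ : Renaming) :
      G = .cut (.alpha x t) (.sum (s₀.append s₁)) (.all A) :: F →
      s₀ ≠ .nil → s₁ ≠ .nil → Forest.IsKingdom G [0, 0] K →
      FreshPair (Forest.Occurs G) (Forest.boundIn G K) τ₀.var τ₁.var →
      FreshPair (Forest.HasIndex G) (Forest.indicesIn G K) τ₀.idx τ₁.idx →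
      Forest.Rule G
        (.cut (.alpha (τ₀.var x) (t.rename τ₀)) (.sum s₀) (.all A) ::
          .cut (.alpha (τ₁.var x) (t.rename τ₁)) (.sum s₁) (.all A) ::
          Forest.dupFrom K τ₀ τ₁ 1 F)

mutual
/-- Equality of trees up to the order of the summands of formal sums. -/
inductive Tree.Eqv : Tree → Tree → Prop
  | leaf (S : Finset ℕ) : Tree.Eqv (.leaf S) (.leaf S)
  | alpha (a : ℕ) {t t' : Tree} : Tree.Eqv t t' → Tree.Eqv (.alpha a t) (.alpha a t')
  | sum {ws ws' : Wits} : Wits.Eqv ws ws' → Tree.Eqv (.sum ws) (.sum ws')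
inductive Wits.Eqv : Wits → Wits → Prop
  | nil : Wits.Eqv .nil .nil
  | cons (M : Tm 0) {t t' : Tree} {ws ws' : Wits} :
      Tree.Eqv t t' → Wits.Eqv ws ws' → Wits.Eqv (.cons M t ws) (.cons M t' ws')
  | swap (M N : Tm 0) (t s : Tree) (ws : Wits) :
      Wits.Eqv (.cons M t (.cons N s ws)) (.cons N s (.cons M t ws))
  | trans {ws ws' ws'' : Wits} : Wits.Eqv ws ws' → Wits.Eqv ws' ws'' → Wits.Eqv ws ws''
end

/-- Equality of roots up to the order of summands and of the two sides of a cut. -/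
inductive Root.Eqv : Root → Root → Prop
  | tree {t t' : Tree} (A : Prenex 0) : Tree.Eqv t t' → Root.Eqv (.tree t A) (.tree t' A)
  | cut {t t' s s' : Tree} (A : Prenex 0) :
      Tree.Eqv t t' → Tree.Eqv s s' → Root.Eqv (.cut t s A) (.cut t' s' A)
  | swap {t t' s s' : Tree} (A : Prenex 0) :
      Tree.Eqv t t' → Tree.Eqv s s' → Root.Eqv (.cut t s A) (.cut s' t' A.dual)

/-- Equality of forests as multisets of roots. -/
def Forest.Eqv (F G : Forest) : Prop :=
  ∃ F' : Forest, List.Perm F F' ∧ List.Forall₂ Root.Eqv F' G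

/-- Equality of forests up to, in addition, a renaming of the eigenvariables and indices. -/
def Forest.Iso (F G : Forest) : Prop :=
  ∃ ρ θ : Equiv.Perm ℕ,
    (∀ a, Forest.Occurs F a → a ∉ Forest.eigenvariables F → ρ a = a) ∧
    Forest.Eqv (Forest.rename ⟨ρ, θ⟩ F) G

/-- One step of minimal reduction from a Herbrand net. -/
def Forest.Step (T : Set (QF 0)) (F G : Forest) : Prop :=
  ∃ F' G', Forest.Eqv F F' ∧ Forest.IsHerbrandNet T F' ∧ Forest.Rule F' G' ∧ Forest.Eqv G' G

/-- Minimal reduction of Herbrand nets, in any number of steps. -/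
def Forest.Reduces (T : Set (QF 0)) : Forest → Forest → Prop :=
  Relation.ReflTransGen (Forest.Step T)

/-- Minimal reduction on the Herbrand nets over `T` is confluent (up to renaming of eigenvariables
and indices). -/
def MinimalReductionConfluent (T : Set (QF 0)) : Prop :=
  ∀ F G H : Forest, Forest.IsHerbrandNet T F → Forest.Reduces T F G → Forest.Reduces T F H →
    ∃ G' H', Forest.Reduces T G G' ∧ Forest.Reduces T H H' ∧ Forest.Iso G' H'

/-! ### The theory of successor and the example -/

/-- The single universal axiom `¬iszero(s(x))`. -/
def succTheory : Set (QF 0) := {.nonzero (.succ (.fvar 0))}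

/-- `∃z.¬iszero(s(z))` -/
def goal : Prenex 0 := .ex (.qf (.nonzero (.succ (.bvar 0))))

/-- The cut formula `∃x.∀y.(¬iszero(x) ∨ iszero(s(y)))` -/
def drinker : Prenex 0 :=
  .ex (.all (.qf (.or (.nonzero (.bvar 0)) (.iszero (.succ (.bvar 1))))))

/-- `ε[0].α[a].{i} + ε[s(a)].α[b].{i}` -/
def drinkerProof (a b i : ℕ) : Tree :=
  .sum (.cons .zero (.alpha a (.leaf {i}))
    (.cons (.succ (.fvar a)) (.alpha b (.leaf {i})) .nil))

/-- With the eigenvariables `a, b, d, e, g, h` numbered `0, …, 5`, the net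
`ε[0].α[a].{1} + ε[s(a)].α[b].{1} ⋈ α[g].ε[h].{2} : A ⋈ Ā`,
`α[h].ε[g].{2} ⋈ ε[0].α[d].{3} + ε[s(d)].α[e].{3} : Ā ⋈ A`,
`ε[h].{2} : ∃z.¬iszero(s(z))`. -/
def exampleNet : Forest :=
  [.cut (drinkerProof 0 1 1) (.alpha 4 (.sum (.cons (.fvar 5) (.leaf {2}) .nil))) drinker,
   .cut (.alpha 5 (.sum (.cons (.fvar 4) (.leaf {2}) .nil))) (drinkerProof 2 3 3) drinker.dual,
   .tree (.sum (.cons (.fvar 5) (.leaf {2}) .nil)) goal]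

/-- The numeral `sᵏ0`. -/
def num : ℕ → Tm 0
  | 0 => .zero
  | k + 1 => .succ (num k)

/-- The net `ε[M₁].{i} + ⋯ + ε[Mₙ].{i} : ∃z.¬iszero(s(z))`. -/
def witnessNet (i : ℕ) (Ms : List (Tm 0)) : Forest :=
  [.tree (.sum (Ms.foldr (fun M ws => Wits.cons M (.leaf {i}) ws) .nil)) goal]

end HerbrandNet

/-!
The theorem is a statement about two explicit reduction sequences of twenty steps each, so the proof
is by reflection: the reduction of a given cut is an executable function (`Forest.contract`), the
conditions that make it a step of minimal reduction on Herbrand nets are replaced by Boolean tests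
that imply them, and the two sequences are evaluated in the kernel (`exampleNet_reduces_three`,
`exampleNet_reduces_four`).  They differ in which of the two cuts of the example is duplicated
first: each duplication copies the dependencies of the duplicated `α`-node, and the two orders
produce different numbers of copies of the only witness of the conclusion.

ACC quantifies over all switchings, but need not be tested switching by switching.  All switching
graphs have the same number of edges, one for each switched node and one for each edge into another
node, so that a connected one is a tree as soon as this number is less than the number of vertices
(`isTree_of_connected_of_card_lt`).  Connectedness for all switchings follows from a contraction: an
edge into a node that is not switched identifies its ends, and a switched node is identified with
the sources of its incoming edges once these are identified with each other, since then the choice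
of the switching does not matter (`rel_of_contracts`, `Forest.Lists.accOn`).

Every subnet that contains a node contains all nodes on which that node depends.  Hence, if these
nodes form a subnet, it is the kingdom (`Forest.isKingdom_of_test`); this is the case for all
duplications in the two sequences.

Validity of the disjunctions is tested by a tableau search (`entails_of_entailsTest`).

Finally, a cut-free net has no reducts, so the two normal forms are joinable only if they are equal
up to renaming, which they are not because renaming and reordering preserve the number of summands
(`length_eq_of_iso_witnessNet`).
-/

namespace HerbrandNet

/-! ### Entailment from the axiom `¬iszero(s(x))` -/

/-- The literal `L` closes a clause that contains the literals `Γ`: it is an instance of the axiom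
`¬iszero(s(x))`, or its dual is in `Γ`. -/
def QF.closes (L : QF 0) (Γ : List (QF 0)) : Bool :=
  match L with
  | .nonzero (.succ _) => true
  | .nonzero t => decide (.iszero t ∈ Γ)
  | .iszero t => decide (.nonzero t ∈ Γ)
  | _ => false

/-- Tableau search for a proof of the disjunction of `P`, of the literals `Γ`, and of the formulae
that the continuation `k` still has to process. -/
def QF.search : QF 0 → (List (QF 0) → Bool) → List (QF 0) → Bool
  | .iszero t, k, Γ => QF.closes (.iszero t) Γ || k (.iszero t :: Γ)
  | .nonzero t, k, Γ => QF.closes (.nonzero t) Γ || k (.nonzero t :: Γ)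
  | .and P Q, k, Γ => P.search k Γ && Q.search k Γ
  | .or P Q, k, Γ => P.search (fun Δ => Q.search k Δ) Γ

/-- A sufficient test for `succTheory ⊨ ⋁ Γ`. -/
def entailsTest (Γ : List (QF 0)) : Bool :=
  Γ.foldr (fun P k => P.search k) (fun _ => false) []

theorem QF.holds_of_closes {D : Type} {S : Struc D} {v : ℕ → D} (hS : ∀ d, ¬ S.iszero (S.succ d))
    {L : QF 0} {Γ : List (QF 0)} (h : L.closes Γ = true) (hL : ¬ L.Holds S v) :
    ∃ Q ∈ Γ, QF.Holds S v Q := by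
  unfold QF.closes at h
  split at h
  · exact absurd (hS _) hL
  · exact ⟨_, of_decide_eq_true h, not_not.1 hL⟩
  · exact ⟨_, of_decide_eq_true h, hL⟩
  · cases h

/-- In a model in which `P` and `Γ` fail, a successful search reaches its continuation with a list
of literals that fail. -/
theorem QF.search_sound {D : Type} {S : Struc D} {v : ℕ → D} (hS : ∀ d, ¬ S.iszero (S.succ d))
    (P : QF 0) (k : List (QF 0) → Bool) (Γ : List (QF 0)) (h : P.search k Γ = true)
    (hP : ¬ P.Holds S v) (hΓ : ∀ Q ∈ Γ, ¬ QF.Holds S v Q) :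
    ∃ Δ, (∀ Q ∈ Δ, ¬ QF.Holds S v Q) ∧ k Δ = true := by
  induction P generalizing k Γ with
  | iszero t | nonzero t =>
    rw [QF.search, Bool.or_eq_true] at h
    rcases h with h | h
    · obtain ⟨Q, hQ, hQ'⟩ := QF.holds_of_closes hS h hP
      exact absurd hQ' (hΓ Q hQ)
    · refine ⟨_, ?_, h⟩
      rintro Q (_ | ⟨_, hQ⟩)
      exacts [hP, hΓ Q hQ]
  | and P Q ihP ihQ =>
    rw [QF.search, Bool.and_eq_true] at h
    by_cases hP' : P.Holds S v
    · exact ihQ k Γ h.2 (fun hQ => hP ⟨hP', hQ⟩) hΓ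
    · exact ihP k Γ h.1 hP' hΓ
  | or P Q ihP ihQ =>
    obtain ⟨Δ, hΔ, h'⟩ := ihP _ Γ h (fun h => hP (.inl h)) hΓ
    exact ihQ k Δ h' (fun h => hP (.inr h)) hΔ

theorem entails_of_entailsTest {Γ : List (QF 0)} (h : entailsTest Γ = true) :
    Entails succTheory {P | P ∈ Γ} := by
  intro D S hT v
  have hS : ∀ d, ¬ S.iszero (S.succ d) := fun d => hT _ rfl fun _ => d
  by_contra! hΓ
  have key : ∀ (Γ : List (QF 0)), (∀ P ∈ Γ, ¬ P.Holds S v) → ∀ Δ : List (QF 0),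
      (∀ Q ∈ Δ, ¬ QF.Holds S v Q) →
      Γ.foldr (fun P k => P.search k) (fun _ => false) Δ = false := by
    intro Γ
    induction Γ with
    | nil => intros; rfl
    | cons P Γ ih =>
      intro hΓ Δ hΔ
      by_contra h
      obtain ⟨Δ', hΔ', h'⟩ := QF.search_sound hS P _ Δ (Bool.eq_true_of_not_eq_false h)
        (hΓ P (by simp)) hΔ
      rw [ih (fun P hP => hΓ P (by simp [hP])) Δ' hΔ'] at h'
      cases h'
  rw [entailsTest, key Γ hΓ [] (by simp)] at h
  cases h

/-! ### Typing, eigenvariables and tautologies -/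

mutual
/-- A Boolean version of the typing judgement. -/
def Tree.hasType : Tree → Prenex 0 → Bool
  | .leaf S, .qf _ => decide S.Nonempty
  | .alpha a t, .all A => t.hasType (A.inst (.fvar a))
  | .sum (.cons M t ws), .ex A => t.hasType (A.inst M) && ws.hasType A
  | _, _ => false
def Wits.hasType : Wits → Prenex 1 → Bool
  | .nil, _ => true
  | .cons M t ws, A => t.hasType (A.inst M) && ws.hasType A
end

mutual
theorem Tree.hasType_sound : (t : Tree) → (A : Prenex 0) → t.hasType A = true → t.HasType A
  | .leaf S, .qf _, h => by
    rw [Tree.hasType] at h; rw [Tree.HasType]; exact of_decide_eq_true h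
  | .alpha a t, .all A, h => by
    rw [Tree.hasType] at h; rw [Tree.HasType]; exact t.hasType_sound _ h
  | .sum (.cons M t ws), .ex A, h => by
    rw [Tree.hasType, Bool.and_eq_true] at h
    rw [Tree.HasType, Wits.HasType]
    exact ⟨nofun, t.hasType_sound _ h.1, ws.hasType_sound _ h.2⟩
  | .leaf _, .all _, h | .leaf _, .ex _, h | .alpha _ _, .qf _, h | .alpha _ _, .ex _, h
  | .sum .nil, _, h | .sum _, .qf _, h | .sum _, .all _, h => by simp [Tree.hasType] at h
theorem Wits.hasType_sound : (ws : Wits) → (A : Prenex 1) → ws.hasType A = true → ws.HasType A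
  | .nil, _, _ => by rw [Wits.HasType]; trivial
  | .cons M t ws, A, h => by
    rw [Wits.hasType, Bool.and_eq_true] at h
    rw [Wits.HasType]
    exact ⟨t.hasType_sound _ h.1, ws.hasType_sound _ h.2⟩
end

/-- The Boolean version of `Root.Typed`. -/
def Root.typed : Root → Bool
  | .tree t A => t.hasType A
  | .cut t s A => t.hasType A && s.hasType A.dual

theorem Root.typed_sound : (R : Root) → R.typed = true → R.Typed
  | .tree t A, h => t.hasType_sound A h
  | .cut t s A, h =>
    have h := (Bool.and_eq_true _ _).mp h
    ⟨t.hasType_sound A h.1, s.hasType_sound _ h.2⟩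

/-- No variable in `l` is free in the type of a non-cut root. -/
def Root.strictFor (l : List ℕ) : Root → Bool
  | .tree _ A => l.all fun a => decide (a ∉ A.free)
  | .cut _ _ _ => true

/-- The Boolean version of `Forest.IsAnnotatedSequent`. -/
def Forest.annotatedTest (F : Forest) : Bool :=
  F.all Root.typed && decide (Forest.eigenvariables F).Nodup &&
    F.all (Root.strictFor (Forest.eigenvariables F))

theorem Forest.isAnnotatedSequent_of_test {F : Forest} (h : Forest.annotatedTest F = true) :
    Forest.IsAnnotatedSequent F := by
  simp only [Forest.annotatedTest, Bool.and_eq_true, List.all_eq_true, decide_eq_true_eq] at h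
  obtain ⟨⟨h1, h2⟩, h3⟩ := h
  refine ⟨fun R hR => R.typed_sound (h1 R hR), h2, fun t A hR a ha => ?_⟩
  have := h3 _ hR
  simp only [Root.strictFor, List.all_eq_true, decide_eq_true_eq] at this
  exact this a ha

/-- The types of the propositional nodes of `F` in which the index `i` occurs. -/
def Forest.typesAt (F : Forest) (i : ℕ) : List (QF 0) :=
  (F.flatMap Root.leaves).filterMap fun x => if i ∈ x.1 then some x.2 else none

/-- A sufficient test for `Forest.IsHerbrandStructure succTheory`.  An index is tested once for each
propositional node in which it occurs. -/
def Forest.structuralTest (F : Forest) : Bool :=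
  (Forest.nodes F).all fun x => match x.2 with
    | .leaf S => decide (∀ i ∈ S, entailsTest (Forest.typesAt F i) = true)
    | _ => true

theorem Forest.isHerbrandStructure_of_test {F : Forest} (h : Forest.structuralTest F = true) :
    Forest.IsHerbrandStructure succTheory F := by
  rintro i ⟨x, S, hx, hi⟩
  have h' := List.all_eq_true.mp h _ hx
  have h'' := entails_of_entailsTest (of_decide_eq_true h' i hi)
  convert h'' using 1
  ext P
  simp only [Forest.typesAt, Set.mem_ofPred_eq, List.mem_filterMap, List.mem_flatMap,
    Option.ite_none_right_eq_some, Option.some.injEq, Prod.exists]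
  grind

/-! ### Contraction of hypergraphs -/

/-- Classes of vertices are encoded as bit masks.  The item `(t, m)` merges the class of the vertex
`t` with a class that contains all vertices of the mask `m`, if there is one. -/
def mergeClasses (cs : List ℕ) (e : ℕ × ℕ) : List ℕ :=
  match cs.find? fun c => (c &&& e.2) == e.2, cs.find? fun c => c.testBit e.1 with
  | some c, some d => (c ||| d) :: (cs.erase c).erase d
  | _, _ => cs

/-- Repeated passes through `items` merge the classes `cs` to the single class of all vertices
`0, …, n - 1`; the last argument but one bounds the number of passes. -/
def contracts (items : List (ℕ × ℕ)) (n : ℕ) : ℕ → List ℕ → Bool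
  | 0, _ => false
  | k + 1, cs => cs == [2 ^ n - 1] || contracts items n k (items.foldl mergeClasses cs)

/-- The relation `R` holds between any two members of a class. -/
def ClassesIn (R : ℕ → ℕ → Prop) (cs : List ℕ) : Prop :=
  ∀ c ∈ cs, ∀ p q, c.testBit p = true → c.testBit q = true → R p q

theorem ClassesIn.mergeClasses {R : ℕ → ℕ → Prop} (hR : Equivalence R) {cs : List ℕ}
    (hcs : ClassesIn R cs) {e : ℕ × ℕ} (he : ∃ p, e.2.testBit p = true ∧ R p e.1) :
    ClassesIn R (mergeClasses cs e) := by
  unfold HerbrandNet.mergeClasses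
  split
  · rename_i c d hc hd
    have hc' := List.mem_of_find?_eq_some hc
    have hd' := List.mem_of_find?_eq_some hd
    have hce := List.find?_some hc
    have hde := List.find?_some hd
    obtain ⟨p, hp, hpt⟩ := he
    have hcp : c.testBit p = true := by
      have := congrArg (Nat.testBit · p) (beq_iff_eq.1 hce)
      simp only [Nat.testBit_and, hp, Bool.and_true] at this
      exact this
    -- All members of the new class are related to the member `p` of the mask.
    have key : ∀ q, (c ||| d).testBit q = true → R p q := by
      intro q hq
      rw [Nat.testBit_or, Bool.or_eq_true] at hq
      rcases hq with hq | hq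
      · exact hcs c hc' p q hcp hq
      · exact hR.trans hpt (hcs d hd' _ q hde hq)
    intro b hb q r hq hr
    rcases List.mem_cons.1 hb with rfl | hb
    · exact hR.trans (hR.symm (key q hq)) (key r hr)
    · exact hcs b (List.mem_of_mem_erase (List.mem_of_mem_erase hb)) q r hq hr
  · exact hcs

/-- If each item `(t, m)` has some member of `m` equivalent to `t`, then contractibility shows that
all vertices are equivalent. -/
theorem rel_of_contracts {R : ℕ → ℕ → Prop} (hR : Equivalence R) {items : List (ℕ × ℕ)} {n : ℕ}
    (h : ∀ e ∈ items, ∃ p, e.2.testBit p = true ∧ R p e.1) (k : ℕ) (cs : List ℕ)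
    (hcs : ClassesIn R cs) (hc : contracts items n k cs = true) {p q : ℕ} (hp : p < n)
    (hq : q < n) : R p q := by
  induction k generalizing cs with
  | zero => cases hc
  | succ k ih =>
    rw [contracts, Bool.or_eq_true] at hc
    rcases hc with hc | hc
    · have hc := beq_iff_eq.1 hc
      subst hc
      exact hcs (2 ^ n - 1) (by simp) p q (by simpa using hp) (by simpa using hq)
    · refine ih _ ?_ hc
      clear ih hc
      induction items generalizing cs with
      | nil => exact hcs
      | cons e items ih =>
        exact ih (fun e he => h e (by simp [he])) _ (hcs.mergeClasses hR (h e (by simp)))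

theorem classesIn_singletons {R : ℕ → ℕ → Prop} (hR : Equivalence R) (n : ℕ) :
    ClassesIn R ((List.range n).map (2 ^ ·)) := by
  intro c hc p q hp hq
  obtain ⟨i, -, rfl⟩ := List.mem_map.1 hc
  simp only [Nat.testBit_two_pow, decide_eq_true_eq] at hp hq
  subst hp hq
  exact hR.refl _

/-! ### Connected graphs with few edges -/

/-- A connected graph that is given by fewer directed edges than it has vertices is a tree, and no
two of the directed edges are opposite. -/
theorem isTree_of_connected_of_card_lt {V : Type*} [Finite V] (r : V → V → Prop)
    (hconn : (SimpleGraph.fromRel r).Connected)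
    (hcard : {e : V × V | r e.1 e.2}.ncard + 1 ≤ Nat.card V) :
    (SimpleGraph.fromRel r).IsTree ∧ ∀ u v, r u v → ¬ r v u := by
  classical
  have hV := hconn.card_vert_le_card_edgeSet_add_one
  -- A set of directed edges that covers the graph has at least as many elements as the graph has
  -- edges.
  have cover : ∀ E : Set (V × V), (∀ u v, r u v → u ≠ v → s(u, v) ∈ (fun e => s(e.1, e.2)) '' E) →
      Nat.card (SimpleGraph.fromRel r).edgeSet ≤ E.ncard := by
    intro E hE
    refine le_trans ?_ (Set.ncard_image_le E.toFinite (f := fun e => s(e.1, e.2)))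
    rw [Nat.card_coe_set_eq]
    refine Set.ncard_le_ncard ?_ (Set.toFinite _)
    intro e
    induction e using Sym2.ind with
    | _ u v =>
      rw [SimpleGraph.mem_edgeSet, SimpleGraph.fromRel_adj]
      rintro ⟨hne, h | h⟩
      · exact hE u v h hne
      · rw [Sym2.eq_swap]; exact hE v u h hne.symm
  have h1 := cover {e | r e.1 e.2} fun u v h _ => ⟨(u, v), h, rfl⟩
  refine ⟨SimpleGraph.isTree_iff_connected_and_card.2 ⟨hconn, ?_⟩, fun u v huv hvu => ?_⟩
  · omega
  · have h2 := cover ({e | r e.1 e.2} \ {(v, u)}) fun x y h hne => by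
      by_cases hxy : (x, y) = (v, u)
      · obtain ⟨rfl, rfl⟩ := Prod.mk.inj hxy
        exact ⟨(y, x), ⟨huv, fun h' => hne (Prod.mk.inj h').2⟩, Sym2.eq_swap⟩
      · exact ⟨(x, y), ⟨h, hxy⟩, rfl⟩
    have h3 := Set.ncard_sdiff_singleton_lt_of_mem (s := {e : V × V | r e.1 e.2}) (a := (v, u)) hvu
    omega

/-! ### Positions of nodes -/

mutual
theorem Tree.suffix_of_mem_nodes : (t : Tree) → (p : Node) → ∀ x ∈ t.nodes p, p <:+ x.1
  | .leaf S, p => by simp [Tree.nodes]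
  | .alpha a t, p => by
    rw [Tree.nodes]
    rintro x (_ | ⟨_, hx⟩)
    · exact List.suffix_rfl
    · exact (List.suffix_cons _ _).trans (t.suffix_of_mem_nodes _ x hx)
  | .sum ws, p => by
    rw [Tree.nodes]
    rintro x (_ | ⟨_, hx⟩)
    · exact List.suffix_rfl
    · obtain ⟨j, -, hj⟩ := ws.suffix_of_mem_nodes p 0 x hx
      exact (List.suffix_cons _ _).trans hj
theorem Wits.suffix_of_mem_nodes : (ws : Wits) → (p : Node) → (i : ℕ) →
    ∀ x ∈ ws.nodes p i, ∃ j, i ≤ j ∧ (j :: p) <:+ x.1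
  | .nil, p, i => by simp [Wits.nodes]
  | .cons M t ws, p, i => by
    rw [Wits.nodes]
    rintro x (_ | ⟨_, hx⟩)
    · exact ⟨i, le_rfl, List.suffix_rfl⟩
    · rcases List.mem_append.1 hx with hx | hx
      · exact ⟨i, le_rfl, (List.suffix_cons _ _).trans (t.suffix_of_mem_nodes _ x hx)⟩
      · obtain ⟨j, hj, h⟩ := ws.suffix_of_mem_nodes p (i + 1) x hx
        exact ⟨j, by omega, h⟩
end

theorem eq_of_cons_suffix {i j : ℕ} {p x : Node} (hi : (i :: p) <:+ x) (hj : (j :: p) <:+ x) :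
    i = j :=
  (List.cons_eq_cons.1 ((List.suffix_of_suffix_length_le hi hj le_rfl).eq_of_length rfl)).1

theorem not_cons_suffix_self {i : ℕ} {p : Node} : ¬ (i :: p) <:+ p := fun h => by
  have := h.length_le
  simp at this

mutual
theorem Tree.nodup_nodes : (t : Tree) → (p : Node) → ((t.nodes p).map Prod.fst).Nodup
  | .leaf S, p => by simp [Tree.nodes]
  | .alpha a t, p => by
    rw [Tree.nodes, List.map_cons, List.nodup_cons]
    refine ⟨fun h => ?_, t.nodup_nodes _⟩
    obtain ⟨x, hx, hxp⟩ := List.mem_map.1 h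
    exact not_cons_suffix_self (hxp ▸ t.suffix_of_mem_nodes _ x hx)
  | .sum ws, p => by
    rw [Tree.nodes, List.map_cons, List.nodup_cons]
    refine ⟨fun h => ?_, ws.nodup_nodes _ _⟩
    obtain ⟨x, hx, hxp⟩ := List.mem_map.1 h
    obtain ⟨j, -, hj⟩ := ws.suffix_of_mem_nodes _ _ x hx
    exact not_cons_suffix_self (hxp ▸ hj)
theorem Wits.nodup_nodes : (ws : Wits) → (p : Node) → (i : ℕ) →
    ((ws.nodes p i).map Prod.fst).Nodup
  | .nil, p, i => by simp [Wits.nodes]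
  | .cons M t ws, p, i => by
    rw [Wits.nodes, List.map_cons, List.nodup_cons, List.map_append, List.nodup_append']
    refine ⟨fun h => ?_, t.nodup_nodes _, ws.nodup_nodes _ _, ?_⟩
    · rcases List.mem_append.1 h with h | h
      · obtain ⟨x, hx, hxp⟩ := List.mem_map.1 h
        exact not_cons_suffix_self (hxp ▸ t.suffix_of_mem_nodes _ x hx)
      · obtain ⟨x, hx, hxp⟩ := List.mem_map.1 h
        obtain ⟨j, hj, h⟩ := ws.suffix_of_mem_nodes _ _ x hx
        have := eq_of_cons_suffix (hxp ▸ h) List.suffix_rfl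
        omega
    · intro y hy hy'
      obtain ⟨x, hx, rfl⟩ := List.mem_map.1 hy
      obtain ⟨x', hx', hxx⟩ := List.mem_map.1 hy'
      obtain ⟨j, hj, h⟩ := ws.suffix_of_mem_nodes _ _ x' hx'
      have := eq_of_cons_suffix (hxx ▸ h)
        ((List.suffix_cons _ _).trans (t.suffix_of_mem_nodes _ x hx))
      omega
end

theorem Root.suffix_of_mem_nodes (R : Root) (r : ℕ) : ∀ x ∈ R.nodes r, [r] <:+ x.1 := by
  cases R with
  | tree t A => exact t.suffix_of_mem_nodes _
  | cut t s A =>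
    rw [Root.nodes]
    rintro x (_ | ⟨_, hx⟩)
    · exact List.suffix_rfl
    · rcases List.mem_append.1 hx with hx | hx
      · exact (List.suffix_cons _ _).trans (t.suffix_of_mem_nodes _ x hx)
      · exact (List.suffix_cons _ _).trans (s.suffix_of_mem_nodes _ x hx)

theorem Root.nodup_nodes (R : Root) (r : ℕ) : ((R.nodes r).map Prod.fst).Nodup := by
  cases R with
  | tree t A => exact t.nodup_nodes _
  | cut t s A =>
    rw [Root.nodes, List.map_cons, List.nodup_cons, List.map_append, List.nodup_append']
    refine ⟨fun h => ?_, t.nodup_nodes _, s.nodup_nodes _, ?_⟩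
    · rcases List.mem_append.1 h with h | h
      · obtain ⟨x, hx, hxp⟩ := List.mem_map.1 h
        exact not_cons_suffix_self (hxp ▸ t.suffix_of_mem_nodes _ x hx)
      · obtain ⟨x, hx, hxp⟩ := List.mem_map.1 h
        exact not_cons_suffix_self (hxp ▸ s.suffix_of_mem_nodes _ x hx)
    · intro y hy hy'
      obtain ⟨x, hx, rfl⟩ := List.mem_map.1 hy
      obtain ⟨x', hx', hxx⟩ := List.mem_map.1 hy'
      have := eq_of_cons_suffix (t.suffix_of_mem_nodes _ x hx)
        (hxx ▸ s.suffix_of_mem_nodes _ x' hx')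
      omega

theorem Forest.suffix_of_mem_nodesFrom (F : Forest) (r : ℕ) :
    ∀ x ∈ Forest.nodesFrom r F, ∃ j, r ≤ j ∧ [j] <:+ x.1 := by
  induction F generalizing r with
  | nil => simp [Forest.nodesFrom]
  | cons R F ih =>
    intro x hx
    rcases List.mem_append.1 hx with hx | hx
    · exact ⟨r, le_rfl, R.suffix_of_mem_nodes r x hx⟩
    · obtain ⟨j, hj, h⟩ := ih (r + 1) x hx
      exact ⟨j, by omega, h⟩

theorem Forest.nodup_nodesFrom (F : Forest) (r : ℕ) :
    ((Forest.nodesFrom r F).map Prod.fst).Nodup := by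
  induction F generalizing r with
  | nil => simp [Forest.nodesFrom]
  | cons R F ih =>
    rw [Forest.nodesFrom, List.map_append, List.nodup_append']
    refine ⟨R.nodup_nodes r, ih _, ?_⟩
    intro y hy hy'
    obtain ⟨x, hx, rfl⟩ := List.mem_map.1 hy
    obtain ⟨x', hx', hxx⟩ := List.mem_map.1 hy'
    obtain ⟨j, hj, h⟩ := Forest.suffix_of_mem_nodesFrom F (r + 1) x' hx'
    have := eq_of_cons_suffix (R.suffix_of_mem_nodes r x hx) (hxx ▸ h)
    omega

theorem Forest.nodup_nodes (F : Forest) : ((Forest.nodes F).map Prod.fst).Nodup :=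
  Forest.nodup_nodesFrom F 0

theorem Forest.Has.label_unique {F : Forest} {x : Node} {l l' : Label} (h : Forest.Has F x l)
    (h' : Forest.Has F x l') : l = l' :=
  (Prod.mk.inj (List.inj_on_of_nodup_map (Forest.nodup_nodes F) h h' rfl)).2

/-! ### The dependency graph as a list of arcs -/

instance instLawfulBEqVertex : LawfulBEq Vertex where
  eq_of_beq {u v} h := by
    cases u <;> cases v
    · exact congrArg Sum.inl (eq_of_beq h)
    · cases h
    · cases h
    · exact congrArg Sum.inr (eq_of_beq h)
  rfl {u} := by
    cases u
    · exact beq_self_eq_true (α := Node) _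
    · exact beq_self_eq_true (α := ℕ) _

/-- The elements of a finite set of natural numbers in increasing order.  Insertion sort is used
because it is structurally recursive, so that the kernel can evaluate it. -/
def sortedList (S : Finset ℕ) : List ℕ :=
  Quotient.liftOn S.val (List.insertionSort (· ≤ ·)) fun l₁ l₂ h =>
    ((List.perm_insertionSort _ l₁).trans
      (h.trans (List.perm_insertionSort _ l₂).symm)).eq_of_pairwise' (r := (· ≤ ·))
      (List.pairwise_insertionSort _ _) (List.pairwise_insertionSort _ _)

theorem mem_sortedList {S : Finset ℕ} {i : ℕ} : i ∈ sortedList S ↔ i ∈ S := by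
  obtain ⟨⟨l⟩, hl⟩ := S
  exact List.mem_insertionSort _

/-- The `α`-nodes among the nodes `L`, with their eigenvariables. -/
def alphas (L : List (Node × Label)) : List (Node × ℕ) :=
  L.filterMap fun x => match x.2 with
    | .alpha a => some (x.1, a)
    | _ => none

/-- The targets of the jumps from a node in which the variables `V` are free. -/
def jumpTargets (L : List (Node × Label)) (V : Finset ℕ) : List Node :=
  (alphas L).filterMap fun y => if y.2 ∈ V then some y.1 else none

/-- The edge from the node `x` to its parent, if the latter is in `L`. -/
def parentArc (L : List (Node × Label)) : Node → List (Vertex × Vertex)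
  | [] => []
  | k :: p => if p ∈ L.map Prod.fst then [(.inl (k :: p), .inl p)] else []

/-- The jumps from a node, and the edges from indices to it. -/
def jumpArcs (L : List (Node × Label)) : Node × Label → List (Vertex × Vertex)
  | (x, .leaf S) => (sortedList S).map fun i => (.inr i, .inl x)
  | (x, .eps M) => (jumpTargets L M.free).map fun y => (.inl x, .inl y)
  | (x, .cut A) => (jumpTargets L A.free).map fun y => (.inl x, .inl y)
  | (_, .alpha _) | (_, .sum) => []

/-- The edges of the dependency graph on the nodes `L`. -/
def arcs (L : List (Node × Label)) : List (Vertex × Vertex) :=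
  L.flatMap fun x => parentArc L x.1 ++ jumpArcs L x

/-- The indices in the label of a node. -/
def Label.indices : Label → List ℕ
  | .leaf S => sortedList S
  | _ => []

/-- Nodes with these labels are the switched ones. -/
def Label.switched : Label → Bool
  | .leaf _ | .alpha _ | .sum => true
  | .eps _ | .cut _ => false

/-- The vertices of the dependency graph on the nodes `L`. -/
def vertexList (L : List (Node × Label)) : List Vertex :=
  L.map (fun x => .inl x.1) ++ (L.flatMap fun x => x.2.indices).dedup.map .inr

/-- `L` lists the nodes in `G`, with their labels in `F`. -/
structure Forest.Lists (F : Forest) (G : Finset Node) (L : List (Node × Label)) : Prop where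
  nodup : (L.map Prod.fst).Nodup
  mem_iff : ∀ x l, (x, l) ∈ L ↔ Forest.Has F x l ∧ x ∈ G
  total : ∀ x ∈ G, ∃ l, Forest.Has F x l

section

variable {F : Forest} {G : Finset Node} {L : List (Node × Label)}

theorem mem_alphas {y : Node} {a : ℕ} : (y, a) ∈ alphas L ↔ (y, .alpha a) ∈ L := by
  simp only [alphas, List.mem_filterMap, Prod.exists]
  constructor
  · rintro ⟨x, l, h, h'⟩
    split at h' <;> grind
  · exact fun h => ⟨y, _, h, rfl⟩

theorem mem_jumpTargets {V : Finset ℕ} {y : Node} :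
    y ∈ jumpTargets L V ↔ ∃ a ∈ V, (y, .alpha a) ∈ L := by
  simp only [jumpTargets, List.mem_filterMap, Prod.exists, mem_alphas]
  grind

theorem Forest.Lists.mem_map_fst (h : Forest.Lists F G L) {x : Node} :
    x ∈ L.map Prod.fst ↔ x ∈ G := by
  simp only [List.mem_map, Prod.exists, h.mem_iff]
  constructor
  · rintro ⟨_, _, h, rfl⟩; exact h.2
  · intro hx
    obtain ⟨l, hl⟩ := h.total x hx
    exact ⟨x, l, ⟨hl, hx⟩, rfl⟩

theorem Forest.Lists.mem_indices (h : Forest.Lists F G L) {i : ℕ} :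
    i ∈ L.flatMap (fun x => x.2.indices) ↔ ∃ x ∈ G, ∃ S, Forest.Has F x (.leaf S) ∧ i ∈ S := by
  simp only [List.mem_flatMap, Prod.exists, h.mem_iff]
  constructor
  · rintro ⟨x, l, ⟨hl, hx⟩, hi⟩
    cases l with
    | leaf S => exact ⟨x, hx, S, hl, mem_sortedList.1 hi⟩
    | _ => cases hi
  · rintro ⟨x, hx, S, hl, hi⟩
    exact ⟨x, _, ⟨hl, hx⟩, mem_sortedList.2 hi⟩

theorem Forest.Lists.mem_vertexList (h : Forest.Lists F G L) {u : Vertex} :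
    u ∈ vertexList L ↔ u ∈ Forest.vertices F G := by
  have h1 := @Forest.Lists.mem_map_fst F G L h
  simp only [List.mem_map] at h1
  simp only [vertexList, Forest.vertices, List.mem_append, List.mem_map, List.mem_dedup,
    h.mem_indices, Set.mem_ofPred_eq, ← h1]
  grind

theorem Forest.Lists.nodup_vertexList (h : Forest.Lists F G L) : (vertexList L).Nodup := by
  rw [vertexList, List.nodup_append']
  refine ⟨?_, (List.nodup_dedup _).map Sum.inr_injective, ?_⟩
  · have := h.nodup.map (f := (Sum.inl : Node → Vertex)) Sum.inl_injective
    rwa [List.map_map] at this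
  · intro u hu hu'
    obtain ⟨x, -, rfl⟩ := List.mem_map.1 hu
    obtain ⟨i, -, hi⟩ := List.mem_map.1 hu'
    cases hi

theorem Forest.Lists.mem_arcs (h : Forest.Lists F G L) {u v : Vertex} :
    (u, v) ∈ arcs L ↔ Forest.DepIn F G u v := by
  have inl_mem : ∀ {x}, (.inl x : Vertex) ∈ Forest.vertices F G ↔ x ∈ G := by
    intro x
    simp [Forest.vertices]
  simp only [arcs, List.mem_flatMap, List.mem_append, Prod.exists]
  constructor
  · rintro ⟨x, l, hx, h' | h'⟩
    · unfold parentArc at h'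
      split at h'
      · cases h'
      · rename_i k p
        split_ifs at h' with hp
        · obtain ⟨rfl, rfl⟩ := Prod.mk.inj (List.mem_singleton.1 h')
          rw [h.mem_map_fst] at hp
          obtain ⟨l', hl'⟩ := h.total p hp
          have hx := (h.mem_iff _ _).1 hx
          exact ⟨.child k p l l' hx.1 hl', inl_mem.2 hx.2, inl_mem.2 hp⟩
        · cases h'
    · have hx' := (h.mem_iff _ _).1 hx
      cases l with
      | leaf S =>
        obtain ⟨i, hi, h'⟩ := List.mem_map.1 h'
        obtain ⟨rfl, rfl⟩ := Prod.mk.inj h'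
        have hi := mem_sortedList.1 hi
        exact ⟨.index i x S hx'.1 hi, .inr ⟨x, hx'.2, S, hx'.1, i, hi, rfl⟩, inl_mem.2 hx'.2⟩
      | alpha a => cases h'
      | sum => cases h'
      | eps M =>
        obtain ⟨y, hy, h'⟩ := List.mem_map.1 h'
        obtain ⟨rfl, rfl⟩ := Prod.mk.inj h'
        obtain ⟨a, ha, hy⟩ := mem_jumpTargets.1 hy
        have hy := (h.mem_iff _ _).1 hy
        exact ⟨.epsJump x y M a hx'.1 hy.1 ha, inl_mem.2 hx'.2, inl_mem.2 hy.2⟩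
      | cut A =>
        obtain ⟨y, hy, h'⟩ := List.mem_map.1 h'
        obtain ⟨rfl, rfl⟩ := Prod.mk.inj h'
        obtain ⟨a, ha, hy⟩ := mem_jumpTargets.1 hy
        have hy := (h.mem_iff _ _).1 hy
        exact ⟨.cutJump x y A a hx'.1 hy.1 ha, inl_mem.2 hx'.2, inl_mem.2 hy.2⟩
  · rintro ⟨h', hu, hv⟩
    cases h' with
    | child k p l l' hl hl' =>
      refine ⟨_, l, (h.mem_iff _ _).2 ⟨hl, inl_mem.1 hu⟩, .inl ?_⟩
      rw [parentArc, if_pos (h.mem_map_fst.2 (inl_mem.1 hv))]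
      exact List.mem_singleton_self _
    | epsJump x y M a hx hy ha =>
      exact ⟨_, _, (h.mem_iff _ _).2 ⟨hx, inl_mem.1 hu⟩, .inr (List.mem_map.2
        ⟨y, mem_jumpTargets.2 ⟨a, ha, (h.mem_iff _ _).2 ⟨hy, inl_mem.1 hv⟩⟩, rfl⟩)⟩
    | cutJump x y A a hx hy ha =>
      exact ⟨_, _, (h.mem_iff _ _).2 ⟨hx, inl_mem.1 hu⟩, .inr (List.mem_map.2
        ⟨y, mem_jumpTargets.2 ⟨a, ha, (h.mem_iff _ _).2 ⟨hy, inl_mem.1 hv⟩⟩, rfl⟩)⟩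
    | index i x S hx hi =>
      exact ⟨_, _, (h.mem_iff _ _).2 ⟨hx, inl_mem.1 hv⟩, .inr (List.mem_map.2
        ⟨i, mem_sortedList.2 hi, rfl⟩)⟩

/-! ### A test for ACC -/

/-- The switched nodes in `L`. -/
def switchedNodes (L : List (Node × Label)) : List Vertex :=
  (L.filter fun x => x.2.switched).map fun x => .inl x.1

/-- The edges that each switching keeps. -/
def plainArcs (L : List (Node × Label)) : List (Vertex × Vertex) :=
  (arcs L).filter fun e => decide (e.2 ∉ switchedNodes L)

/-- The sources of the edges to `v`. -/
def sources (L : List (Node × Label)) (v : Vertex) : List Vertex :=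
  (arcs L).filterMap fun e => if e.2 == v then some e.1 else none

/-- The mask of a list of vertices that are numbered by their positions in `V`. -/
def mask (V l : List Vertex) : ℕ := l.foldr (fun u m => 2 ^ V.idxOf u ||| m) 0

/-- The items of the contraction: an edge that is always kept merges the classes of its ends, and a
switched node joins a class that contains all sources of its incoming edges. -/
def contractionItems (L : List (Node × Label)) : List (ℕ × ℕ) :=
  (plainArcs L).map (fun e => ((vertexList L).idxOf e.2, mask (vertexList L) [e.1])) ++
    (switchedNodes L).map fun v => ((vertexList L).idxOf v, mask (vertexList L) (sources L v))

/-- A sufficient test for ACC: the number of edges in a switching graph is small enough, and the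
contraction identifies all vertices.  Each effective pass removes a class, so that as many passes as
there are vertices suffice, with one more call to recognize the result. -/
def accTest (L : List (Node × Label)) : Bool :=
  decide ((plainArcs L).length + (switchedNodes L).length + 1 ≤ (vertexList L).length) &&
    contracts (contractionItems L) (vertexList L).length ((vertexList L).length + 1)
      ((List.range (vertexList L).length).map (2 ^ ·))

theorem testBit_mask {V l : List Vertex} {u : Vertex} (h : u ∈ l) :
    (mask V l).testBit (V.idxOf u) = true := by
  induction l with
  | nil => cases h
  | cons w l ih =>
    rw [mask, List.foldr_cons, Nat.testBit_or, Bool.or_eq_true]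
    rcases List.mem_cons.1 h with rfl | h
    · exact .inl Nat.testBit_two_pow_self
    · exact .inr (ih h)

theorem Forest.Lists.mem_switchedNodes (h : Forest.Lists F G L) {v : Vertex} :
    v ∈ switchedNodes L ↔ ∃ x ∈ G, Forest.Switched F x ∧ v = .inl x := by
  simp only [switchedNodes, List.mem_map, List.mem_filter, Prod.exists, h.mem_iff]
  constructor
  · rintro ⟨x, l, ⟨⟨hl, hx⟩, hs⟩, rfl⟩
    refine ⟨x, hx, ?_, rfl⟩
    cases l with
    | leaf S => exact .inr (.inr ⟨S, hl⟩)
    | alpha a => exact .inl ⟨a, hl⟩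
    | sum => exact .inr (.inl hl)
    | eps M => cases hs
    | cut A => cases hs
  · rintro ⟨x, hx, ⟨a, hl⟩ | hl | ⟨S, hl⟩, rfl⟩
    exacts [⟨x, _, ⟨⟨hl, hx⟩, rfl⟩, rfl⟩, ⟨x, _, ⟨⟨hl, hx⟩, rfl⟩, rfl⟩,
      ⟨x, _, ⟨⟨hl, hx⟩, rfl⟩, rfl⟩]

/-- A switching keeps one edge per switched node and the edges to the other nodes. -/
theorem Forest.Lists.mem_of_switchEdge (h : Forest.Lists F G L) {σ : Node → Vertex} {u v : Vertex}
    (huv : Forest.SwitchEdge F G σ u v) :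
    (u, v) ∈ plainArcs L ++ (switchedNodes L).map fun v => (v.elim σ .inr, v) := by
  by_cases hv : v ∈ switchedNodes L
  · refine List.mem_append_right _ (List.mem_map.2 ⟨v, hv, ?_⟩)
    obtain ⟨x, -, hs, rfl⟩ := h.mem_switchedNodes.1 hv
    rw [huv.2 x rfl hs, Sum.elim_inl]
  · exact List.mem_append_left _ (List.mem_filter.2 ⟨h.mem_arcs.2 huv.1, decide_eq_true hv⟩)

theorem Forest.Lists.accOn (h : Forest.Lists F G L) (hL : accTest L = true) :
    Forest.ACCOn F G := by
  rw [accTest, Bool.and_eq_true, decide_eq_true_eq] at hL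
  obtain ⟨hlen, hcon⟩ := hL
  have hV : Forest.vertices F G = ((vertexList L).toFinset : Set Vertex) := by
    ext u; simp [h.mem_vertexList]
  have : Finite (Forest.vertices F G) := by rw [hV]; infer_instance
  have hcard : Nat.card (Forest.vertices F G) = (vertexList L).length := by
    rw [Nat.card_coe_set_eq, hV, Set.ncard_coe_finset,
      List.toFinset_card_of_nodup h.nodup_vertexList]
  intro σ hσ
  refine isTree_of_connected_of_card_lt (V := Forest.vertices F G)
    (fun u v => Forest.SwitchEdge F G σ u v) ?_ ?_ |>.imp_right ?_
  · -- Number the vertices, and contract.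
    have h0 : 0 < (vertexList L).length := by omega
    let f : ℕ → Forest.vertices F G := fun p =>
      if hp : p < (vertexList L).length then
        ⟨(vertexList L)[p], h.mem_vertexList.1 (List.getElem_mem hp)⟩
      else ⟨(vertexList L)[0], h.mem_vertexList.1 (List.getElem_mem h0)⟩
    have hf : ∀ u : Forest.vertices F G, f ((vertexList L).idxOf u.1) = u := by
      intro u
      have hu := List.idxOf_lt_length_iff.2 (h.mem_vertexList.2 u.2)
      apply Subtype.ext
      simp only [f, dif_pos hu, List.getElem_idxOf]
    have hR : Equivalence fun p q => (Forest.switchingGraph F G σ).Reachable (f p) (f q) :=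
      ⟨fun _ => .rfl, .symm, .trans⟩
    have edge : ∀ u v, Forest.SwitchEdge F G σ u v → (Forest.switchingGraph F G σ).Reachable
        (f ((vertexList L).idxOf u)) (f ((vertexList L).idxOf v)) := by
      intro u v huv
      by_cases huv' : u = v
      · rw [huv']
      rw [hf ⟨u, huv.1.2.1⟩, hf ⟨v, huv.1.2.2⟩]
      refine SimpleGraph.Adj.reachable ?_
      rw [Forest.switchingGraph, SimpleGraph.fromRel_adj]
      exact ⟨fun h => huv' (Subtype.ext_iff.1 h), .inl huv⟩
    have key := fun {p q} => rel_of_contracts hR (n := (vertexList L).length) (p := p) (q := q)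
      ?_ _ _ (classesIn_singletons hR _) hcon
    · rw [SimpleGraph.connected_iff]
      refine ⟨fun u v => ?_, ⟨f 0⟩⟩
      have := key (List.idxOf_lt_length_iff.2 (h.mem_vertexList.2 u.2))
        (List.idxOf_lt_length_iff.2 (h.mem_vertexList.2 v.2))
      rwa [hf, hf] at this
    · intro e he
      rcases List.mem_append.1 he with he | he
      · obtain ⟨⟨u, v⟩, huv, rfl⟩ := List.mem_map.1 he
        refine ⟨_, testBit_mask (List.mem_singleton_self u), edge u v ?_⟩
        obtain ⟨huv, hv⟩ := List.mem_filter.1 huv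
        have huv := h.mem_arcs.1 huv
        refine ⟨huv, ?_⟩
        rintro x rfl hx
        refine absurd (h.mem_switchedNodes.2 ⟨x, ?_, hx, rfl⟩) (of_decide_eq_true hv)
        simpa [Forest.vertices] using huv.2.2
      · obtain ⟨v, hv, rfl⟩ := List.mem_map.1 he
        obtain ⟨x, hx, hs, rfl⟩ := h.mem_switchedNodes.1 hv
        have hσx := hσ x hx hs
        refine ⟨_, testBit_mask (u := σ x) ?_, edge _ _ ⟨hσx, ?_⟩⟩
        · exact List.mem_filterMap.2 ⟨(σ x, .inl x), h.mem_arcs.2 hσx, if_pos (beq_self_eq_true _)⟩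
        · rintro y hy -
          rw [Sum.inl.inj hy]
  · -- Count the edges.
    rw [hcard]
    refine le_trans (Nat.succ_le_succ ?_) hlen
    rw [← Set.ncard_image_of_injective _
      (Function.Injective.prodMap Subtype.val_injective Subtype.val_injective)]
    refine (Set.ncard_le_ncard (t := (List.toFinset (plainArcs L ++
      (switchedNodes L).map fun v => (v.elim σ .inr, v)) : Set (Vertex × Vertex))) ?_
      (Finset.finite_toSet _)).trans ?_
    · rintro _ ⟨⟨u, v⟩, huv, rfl⟩
      exact List.mem_toFinset.2 (h.mem_of_switchEdge huv)
    · rw [Set.ncard_coe_finset]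
      refine (List.toFinset_card_le _).trans ?_
      rw [List.length_append, List.length_map]
  · intro hr u v huv hvu
    exact hr ⟨u, huv.1.2.1⟩ ⟨v, huv.1.2.2⟩ huv hvu

end

theorem Forest.lists_nodes (F : Forest) :
    Forest.Lists F (Forest.nodeSet F) (Forest.nodes F) := by
  have total : ∀ x ∈ Forest.nodeSet F, ∃ l, Forest.Has F x l := by
    intro x hx
    obtain ⟨⟨y, l⟩, h, rfl⟩ := List.mem_map.1 (List.mem_toFinset.1 hx)
    exact ⟨l, h⟩
  refine ⟨Forest.nodup_nodes F, fun x l => ?_, total⟩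
  exact ⟨fun h => ⟨h, List.mem_toFinset.2 (List.mem_map.2 ⟨_, h, rfl⟩)⟩, And.left⟩

/-- A sufficient test for being a Herbrand net over `succTheory`. -/
def Forest.netTest (F : Forest) : Bool :=
  Forest.annotatedTest F && Forest.structuralTest F && accTest (Forest.nodes F)

theorem Forest.isHerbrandNet_of_test {F : Forest} (h : Forest.netTest F = true) :
    Forest.IsHerbrandNet succTheory F := by
  rw [Forest.netTest, Bool.and_eq_true, Bool.and_eq_true] at h
  exact ⟨Forest.isAnnotatedSequent_of_test h.1.1, Forest.isHerbrandStructure_of_test h.1.2,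
    (Forest.lists_nodes F).accOn h.2⟩

/-! ### Kingdoms that are dependency closures -/

/-- Depth-first search, with a bounded number of steps, for the nodes from which a node on the stack
can be reached; the last argument collects the nodes found. -/
def downSearch (A : List (Vertex × Vertex)) : ℕ → List Node → List Node → List Node
  | 0, _, acc => acc
  | _ + 1, [], acc => acc
  | k + 1, y :: st, acc =>
    if y ∈ acc then downSearch A k st acc
    else downSearch A k ((A.filterMap fun e =>
      if e.2 == .inl y then e.1.elim some fun _ => none else none) ++ st) (y :: acc)

/-- The nodes that the node `x` depends on, with their labels.  If the bound on the steps of the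
search is too small then the list is incomplete, and fails `Forest.kingdomTest`. -/
def Forest.downNodes (F : Forest) (x : Node) : List (Node × Label) :=
  let N := Forest.nodes F
  let D := downSearch (arcs N) (2 * N.length) [x] []
  N.filter fun y => decide (y.1 ∈ D)

/-- A sufficient test for `L` to be the kingdom of `x`: it is closed under dependency, it is ACC, and
it contains `x` but not the parent of `x`. -/
def Forest.kingdomTest (F : Forest) (x : Node) (L : List (Node × Label)) : Bool :=
  (arcs (Forest.nodes F)).all (fun e =>
      !(L.map fun y => Sum.inl y.1).contains e.2 || e.1.isRight ||
        (L.map fun y => Sum.inl y.1).contains e.1) &&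
    decide (x ∈ L.map Prod.fst) && decide (x.tail ∉ L.map Prod.fst) && accTest L

theorem Forest.mem_arcs_nodes {F : Forest} {u v : Vertex} :
    (u, v) ∈ arcs (Forest.nodes F) ↔ Forest.Dep F u v := by
  rw [(Forest.lists_nodes F).mem_arcs]
  refine ⟨And.left, fun h => ⟨h, ?_⟩⟩
  have node : ∀ {x l}, Forest.Has F x l → x ∈ Forest.nodeSet F := fun h =>
    List.mem_toFinset.2 (List.mem_map.2 ⟨_, h, rfl⟩)
  cases h with
  | child k p l l' h h' => exact ⟨.inl ⟨_, node h, rfl⟩, .inl ⟨_, node h', rfl⟩⟩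
  | epsJump x y M a h h' => exact ⟨.inl ⟨_, node h, rfl⟩, .inl ⟨_, node h', rfl⟩⟩
  | cutJump x y M a h h' => exact ⟨.inl ⟨_, node h, rfl⟩, .inl ⟨_, node h', rfl⟩⟩
  | index i x S h hi => exact ⟨.inr ⟨_, node h, S, h, i, hi, rfl⟩, .inl ⟨_, node h, rfl⟩⟩

theorem Forest.depends_of_mem_downSearch {F : Forest} {x : Node} (k : ℕ) (st acc : List Node)
    (hst : ∀ y ∈ st, Forest.Depends F y x) (hacc : ∀ y ∈ acc, Forest.Depends F y x) :
    ∀ y ∈ downSearch (arcs (Forest.nodes F)) k st acc, Forest.Depends F y x := by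
  induction k generalizing st acc with
  | zero => exact hacc
  | succ k ih =>
    cases st with
    | nil => exact hacc
    | cons y st =>
      rw [downSearch]
      have hy := hst y (by simp)
      split_ifs
      · exact ih _ _ (fun z hz => hst z (by simp [hz])) hacc
      · refine ih _ _ (fun z hz => ?_) (fun z hz => ?_)
        · rcases List.mem_append.1 hz with hz | hz
          · obtain ⟨⟨u, v⟩, huv, hz⟩ := List.mem_filterMap.1 hz
            split_ifs at hz with hv
            have hv := eq_of_beq hv
            subst hv
            rcases u with u | u
            · obtain rfl := Option.some.inj hz
              exact Relation.ReflTransGen.head (Forest.mem_arcs_nodes.1 huv) hy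
            · cases hz
          · exact hst z (by simp [hz])
        · rcases List.mem_cons.1 hz with rfl | hz
          exacts [hy, hacc z hz]

theorem Forest.depends_of_mem_downNodes {F : Forest} {x y : Node} {l : Label}
    (h : (y, l) ∈ Forest.downNodes F x) : Forest.Depends F y x :=
  Forest.depends_of_mem_downSearch _ [x] [] (by simp [Forest.Depends, Relation.ReflTransGen.refl])
    (by simp) y (of_decide_eq_true (List.mem_filter.1 h).2)

theorem Forest.lists_downNodes (F : Forest) (x : Node) :
    Forest.Lists F ((Forest.downNodes F x).map Prod.fst).toFinset (Forest.downNodes F x) := by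
  refine ⟨(Forest.nodup_nodes F).sublist (List.filter_sublist.map _), fun y l => ?_, fun y hy => ?_⟩
  · refine ⟨fun h => ⟨(List.mem_filter.1 h).1, List.mem_toFinset.2 (List.mem_map.2 ⟨_, h, rfl⟩)⟩, ?_⟩
    rintro ⟨hl, hy⟩
    obtain ⟨⟨z, l'⟩, hz, rfl⟩ := List.mem_map.1 (List.mem_toFinset.1 hy)
    exact List.mem_filter.2 ⟨hl, (List.mem_filter.1 hz).2⟩
  · obtain ⟨⟨z, l'⟩, hz, rfl⟩ := List.mem_map.1 (List.mem_toFinset.1 hy)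
    exact ⟨l', (List.mem_filter.1 hz).1⟩

theorem Forest.dep_inl {F : Forest} {x : Node} {v : Vertex} (h : Forest.Dep F (.inl x) v) :
    ∃ y, v = .inl y := by
  cases h <;> exact ⟨_, rfl⟩

/-- If the dependency closure of `x` is a subnet, then it is the kingdom of `x`. -/
theorem Forest.isKingdom_of_test {F : Forest} {x : Node}
    (h : Forest.kingdomTest F x (Forest.downNodes F x) = true) :
    Forest.IsKingdom F x ((Forest.downNodes F x).map Prod.fst).toFinset := by
  simp only [Forest.kingdomTest, Bool.and_eq_true, decide_eq_true_eq, List.all_eq_true] at h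
  obtain ⟨⟨⟨hcl, hx⟩, hx'⟩, hacc⟩ := h
  have hL := Forest.lists_downNodes F x
  have hmem : ∀ y, (Sum.inl y : Vertex) ∈ (Forest.downNodes F x).map (fun y => Sum.inl y.1) ↔
      y ∈ ((Forest.downNodes F x).map Prod.fst).toFinset := by
    intro y; simp
  refine ⟨⟨⟨?_, ?_, hL.accOn hacc⟩, List.mem_toFinset.2 hx, fun h => hx' (List.mem_toFinset.1 h)⟩,
    ?_⟩
  · intro y hy
    obtain ⟨l, hl⟩ := hL.total y hy
    exact List.mem_toFinset.2 (List.mem_map.2 ⟨_, hl, rfl⟩)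
  · intro y z hz hyz
    unfold Forest.Depends at hyz
    generalize hu : (Sum.inl y : Vertex) = u at hyz
    induction hyz using Relation.ReflTransGen.head_induction_on generalizing y with
    | refl => cases hu; exact hz
    | head h _ ih =>
      subst hu
      obtain ⟨y', rfl⟩ := Forest.dep_inl h
      have := hcl _ (Forest.mem_arcs_nodes.2 h)
      simp only [Bool.or_eq_true, List.contains_iff_mem, Bool.not_eq_true', hmem,
        Sum.isRight_inl, Bool.false_eq_true, or_false] at this
      rcases this with h' | h'
      · have := (hmem y').2 (ih y' rfl)
        rw [← List.contains_iff_mem, h'] at this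
        cases this
      · exact h'
  · rintro G ⟨hG, hxG, -⟩ y hy
    obtain ⟨⟨z, l⟩, hz, rfl⟩ := List.mem_map.1 (List.mem_toFinset.1 hy)
    exact hG.closed _ _ hxG (Forest.depends_of_mem_downNodes hz)

/-! ### Fresh names -/

/-- The renaming that adds `b` to the elements of `V`. -/
def shift (V : List ℕ) (b a : ℕ) : ℕ := if a ∈ V then b + a else a

/-- If `b` bounds the used names, then adding `b` and adding `2 * b` yields disjoint families of
fresh names. -/
theorem freshPair_shift {used : ℕ → Prop} {V : List ℕ} {W : Set ℕ} {b : ℕ}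
    (hb : ∀ a, used a → a < b) (hV : ∀ a, a ∈ V ↔ a ∈ W) (hW : ∀ a ∈ W, used a) :
    FreshPair used W (shift V b) (shift V (b + b)) := by
  have h1 : ∀ c, ∀ a ∈ W, shift V c a = c + a := fun c a ha => if_pos ((hV a).2 ha)
  have h2 : ∀ c, ∀ a ∉ W, shift V c a = a := fun c a ha => if_neg fun h => ha ((hV a).1 h)
  refine ⟨h2 b, h2 _, ?_, ?_, ?_, ?_, ?_⟩
  · intro x hx y hy h
    rw [h1 _ x hx, h1 _ y hy] at h; omega
  · intro x hx y hy h
    rw [h1 _ x hx, h1 _ y hy] at h; omega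
  · intro a ha h
    rw [h1 _ a ha] at h; have := hb _ h; omega
  · intro a ha h
    rw [h1 _ a ha] at h; have := hb _ h; omega
  · intro x hx y hy h
    rw [h1 _ x hx, h1 _ y hy] at h
    have := hb _ (hW x hx); omega

/-- The variables that occur in the label of a node. -/
def Label.vars : Label → Finset ℕ
  | .alpha a => {a}
  | .eps M => M.free
  | .cut A => A.free
  | _ => ∅

/-- The free variables of the formula carried by a root. -/
def Root.typeVars : Root → Finset ℕ
  | .tree _ A => A.free
  | .cut _ _ A => A.free

/-- A strict upper bound for the variables that occur in `F`. -/
def Forest.varBound (F : Forest) : ℕ :=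
  ((Forest.nodes F).map (fun x => x.2.vars.sup id) ++ F.map fun R => R.typeVars.sup id).foldr max 0
    + 1

/-- A strict upper bound for the indices that occur in `F`. -/
def Forest.indexBound (F : Forest) : ℕ :=
  ((Forest.nodes F).flatMap fun x => x.2.indices).foldr max 0 + 1

theorem le_foldr_max {l : List ℕ} {a : ℕ} (h : a ∈ l) : a ≤ l.foldr max 0 := by
  induction l with
  | nil => cases h
  | cons b l ih =>
    rw [List.foldr_cons]
    rcases List.mem_cons.1 h with rfl | h
    exacts [le_max_left _ _, (ih h).trans (le_max_right _ _)]

theorem Forest.mem_eigenvariables {F : Forest} {a : ℕ} :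
    a ∈ Forest.eigenvariables F ↔ ∃ x, Forest.Has F x (.alpha a) := by
  simp only [Forest.eigenvariables, List.mem_filterMap, Prod.exists]
  constructor
  · rintro ⟨x, l, h, h'⟩
    split at h' <;> simp_all [Forest.Has]
    exact ⟨x, h⟩
  · rintro ⟨x, h⟩
    exact ⟨x, _, h, rfl⟩

theorem Forest.lt_varBound {F : Forest} {a : ℕ} (h : Forest.Occurs F a) :
    a < Forest.varBound F := by
  have label : ∀ x l, Forest.Has F x l → a ∈ l.vars → a < Forest.varBound F := by
    intro x l hx ha
    refine Nat.lt_succ_of_le ((Finset.le_sup (f := id) ha).trans (le_foldr_max ?_))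
    exact List.mem_append_left _ (List.mem_map.2 ⟨_, hx, rfl⟩)
  have root : ∀ R ∈ F, a ∈ R.typeVars → a < Forest.varBound F := by
    intro R hR ha
    refine Nat.lt_succ_of_le ((Finset.le_sup (f := id) ha).trans (le_foldr_max ?_))
    exact List.mem_append_right _ (List.mem_map.2 ⟨_, hR, rfl⟩)
  rcases h with h | ⟨x, M, hx, ha⟩ | ⟨t, A, hR, ha⟩ | ⟨t, s, A, hR, ha⟩
  · obtain ⟨x, hx⟩ := Forest.mem_eigenvariables.1 h
    exact label x _ hx (Finset.mem_singleton_self a)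
  · exact label x _ hx ha
  · exact root _ hR ha
  · exact root _ hR ha

theorem Forest.lt_indexBound {F : Forest} {i : ℕ} (h : Forest.HasIndex F i) :
    i < Forest.indexBound F := by
  obtain ⟨x, S, hx, hi⟩ := h
  exact Nat.lt_succ_of_le (le_foldr_max (List.mem_flatMap.2 ⟨_, hx, mem_sortedList.2 hi⟩))

/-- The renaming of the eigenvariables and indices of the nodes `L` that adds `b` to the former and
`c` to the latter. -/
def shiftRenaming (L : List (Node × Label)) (b c : ℕ) : Renaming where
  var := shift ((alphas L).map Prod.snd) b
  idx := shift (L.flatMap fun x => x.2.indices) c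

theorem Forest.Lists.freshPair_var {F : Forest} {G : Finset Node} {L : List (Node × Label)}
    (h : Forest.Lists F G L) (c c' : ℕ) :
    FreshPair (Forest.Occurs F) (Forest.boundIn F G) (shiftRenaming L (Forest.varBound F) c).var
      (shiftRenaming L (Forest.varBound F + Forest.varBound F) c').var := by
  refine freshPair_shift (fun a => Forest.lt_varBound) (fun a => ?_) ?_
  · simp only [List.mem_map, Prod.exists, mem_alphas, h.mem_iff, exists_eq_right, Forest.boundIn,
      Set.mem_ofPred_eq]
    exact exists_congr fun _ => and_comm
  · rintro a ⟨x, -, hx⟩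
    exact .inl (Forest.mem_eigenvariables.2 ⟨x, hx⟩)

theorem Forest.Lists.freshPair_idx {F : Forest} {G : Finset Node} {L : List (Node × Label)}
    (h : Forest.Lists F G L) (b b' : ℕ) :
    FreshPair (Forest.HasIndex F) (Forest.indicesIn F G)
      (shiftRenaming L b (Forest.indexBound F)).idx
      (shiftRenaming L b' (Forest.indexBound F + Forest.indexBound F)).idx :=
  freshPair_shift (fun _ => Forest.lt_indexBound) (fun _ => h.mem_indices)
    fun _ ⟨x, _, S, hx, hi⟩ => ⟨x, S, hx, hi⟩

/-! ### Executable minimal reduction -/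

mutual
theorem Tree.Eqv.refl : (t : Tree) → Tree.Eqv t t
  | .leaf S => .leaf S
  | .alpha a t => .alpha a (Tree.Eqv.refl t)
  | .sum ws => .sum (Wits.Eqv.refl ws)
theorem Wits.Eqv.refl : (ws : Wits) → Wits.Eqv ws ws
  | .nil => .nil
  | .cons M t ws => .cons M (Tree.Eqv.refl t) (Wits.Eqv.refl ws)
end

theorem Root.Eqv.refl : (R : Root) → Root.Eqv R R
  | .tree t A => .tree A (.refl t)
  | .cut t s A => .cut A (.refl t) (.refl s)

theorem Forest.Eqv.refl (F : Forest) : Forest.Eqv F F :=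
  ⟨F, .refl F, List.forall₂_same.2 fun R _ => .refl R⟩

/-- The same cut, with an `α`-node on the left if it has one. -/
def Root.orient : Root → Root
  | .cut t (.alpha a s) A => .cut (.alpha a s) t A.dual
  | R => R

theorem Root.eqv_orient (R : Root) : Root.Eqv R R.orient := by
  unfold Root.orient
  split
  · exact .swap _ (.refl _) (.refl _)
  · exact .refl R

/-- The forest `F` with its `r`-th root moved to the front and oriented. -/
def Forest.focus (r : ℕ) (F : Forest) : Forest :=
  match F[r]? with
  | some R => R.orient :: F.eraseIdx r
  | none => F

theorem Forest.eqv_focus (r : ℕ) (F : Forest) : Forest.Eqv F (Forest.focus r F) := by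
  unfold Forest.focus
  split
  · rename_i R hR
    obtain ⟨hr, rfl⟩ := List.getElem?_eq_some_iff.1 hR
    exact ⟨_, (List.getElem_cons_eraseIdx_perm hr).symm,
      .cons (Root.eqv_orient _) (List.forall₂_same.2 fun R _ => .refl R)⟩
  · exact .refl F

/-- Reduction of the first root.  A sum with several summands is split into its first summand and
the rest, provided that the kingdom is a dependency closure. -/
def Forest.contract : Forest → Option Forest
  | .cut (.leaf S) (.leaf S') (.qf _) :: F =>
    match sortedList S, sortedList S' with
    | [i], [j] => some (Forest.rename (Renaming.index i j) F)
    | _, _ => none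
  | .cut (.alpha a t) (.sum (.cons M s .nil)) (.all A) :: F =>
    some (.cut (t.subst a M) (s.subst a M) (A.inst M) :: Forest.subst a M F)
  | .cut (.alpha x t) (.sum (.cons M s (.cons N u ws))) (.all A) :: F =>
    let G : Forest := .cut (.alpha x t) (.sum (.cons M s (.cons N u ws))) (.all A) :: F
    let L := Forest.downNodes G [0, 0]
    let τ₀ := shiftRenaming L (Forest.varBound G) (Forest.indexBound G)
    let τ₁ := shiftRenaming L (Forest.varBound G + Forest.varBound G)
      (Forest.indexBound G + Forest.indexBound G)
    if Forest.kingdomTest G [0, 0] L then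
      some (.cut (.alpha (τ₀.var x) (t.rename τ₀)) (.sum (.cons M s .nil)) (.all A) ::
        .cut (.alpha (τ₁.var x) (t.rename τ₁)) (.sum (.cons N u ws)) (.all A) ::
        Forest.dupFrom (L.map Prod.fst).toFinset τ₀ τ₁ 1 F)
    else none
  | _ => none

theorem eq_singleton_of_sortedList {S : Finset ℕ} {i : ℕ} (h : sortedList S = [i]) : S = {i} := by
  ext j
  rw [← mem_sortedList, h, List.mem_singleton, Finset.mem_singleton]

theorem Forest.rule_of_contract {F G : Forest} (h : Forest.contract F = some G) :
    Forest.Rule F G := by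
  unfold Forest.contract at h
  split at h
  · split at h
    · rename_i hi hj
      obtain rfl := Option.some.inj h
      rw [eq_singleton_of_sortedList hi, eq_singleton_of_sortedList hj]
      exact .prop _ _ _ _
    · cases h
  · obtain rfl := Option.some.inj h
    exact .comm _ _ _ _ _ _
  · rename_i x t M s N u ws A F
    simp only at h
    split_ifs at h with hK
    obtain rfl := Option.some.inj h
    refine Forest.Rule.dup x t (.cons M s .nil) (.cons N u ws) A F _ _ _ _ rfl nofun nofun
      (Forest.isKingdom_of_test hK) (Forest.Lists.freshPair_var ?_ _ _)
      (Forest.Lists.freshPair_idx ?_ _ _) <;>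
    exact Forest.lists_downNodes _ _
  · cases h

/-- The reductions of the roots number `rs`, one after the other, with a check that the forests on
the way are Herbrand nets. -/
def Forest.run : List ℕ → Forest → Option Forest
  | [], F => some F
  | r :: rs, F =>
    match Forest.netTest (Forest.focus r F), Forest.contract (Forest.focus r F) with
    | true, some G => Forest.run rs G
    | _, _ => none

theorem Forest.reduces_of_run {rs : List ℕ} {F G : Forest} (h : Forest.run rs F = some G) :
    Forest.Reduces succTheory F G := by
  induction rs generalizing F with
  | nil => obtain rfl := Option.some.inj h; exact .refl
  | cons r rs ih =>
    rw [Forest.run] at h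
    split at h
    · rename_i F' hnet hF'
      exact .head ⟨_, F', Forest.eqv_focus r F, Forest.isHerbrandNet_of_test hnet,
        Forest.rule_of_contract hF', .refl F'⟩ (ih h)
    · cases h

/-- A Boolean test for the summands `ε[M₁].{i} + ⋯ + ε[Mₙ].{i}`. -/
def Wits.hasWitnesses (i : ℕ) : Wits → List (Tm 0) → Bool
  | .nil, [] => true
  | .cons M (.leaf S) ws, N :: Ms => decide (M = N) && decide (S = {i}) && ws.hasWitnesses i Ms
  | _, _ => false

/-- A Boolean test for equality with `witnessNet i Ms`. -/
def Forest.isWitnessNet (i : ℕ) (Ms : List (Tm 0)) : Forest → Bool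
  | [.tree (.sum ws) (.ex (.qf P))] =>
    ws.hasWitnesses i Ms && decide (P = .nonzero (.succ (.bvar 0)))
  | _ => false

theorem Wits.eq_of_hasWitnesses {i : ℕ} : {ws : Wits} → {Ms : List (Tm 0)} →
    ws.hasWitnesses i Ms = true → ws = Ms.foldr (fun M ws => Wits.cons M (.leaf {i}) ws) .nil
  | .nil, [], _ => rfl
  | .cons M (.leaf S) ws, N :: Ms, h => by
    simp only [Wits.hasWitnesses, Bool.and_eq_true, decide_eq_true_eq] at h
    obtain ⟨⟨rfl, rfl⟩, h⟩ := h
    rw [List.foldr_cons, ← Wits.eq_of_hasWitnesses h]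
  | .nil, _ :: _, h | .cons _ _ _, [], h | .cons _ (.alpha _ _) _, _ :: _, h
  | .cons _ (.sum _) _, _ :: _, h => by simp [Wits.hasWitnesses] at h

theorem Forest.eq_witnessNet {i : ℕ} {Ms : List (Tm 0)} {F : Forest}
    (h : Forest.isWitnessNet i Ms F = true) : F = witnessNet i Ms := by
  unfold Forest.isWitnessNet at h
  split at h
  · simp only [Bool.and_eq_true, decide_eq_true_eq] at h
    rw [Wits.eq_of_hasWitnesses h.1, h.2]
    rfl
  · cases h

theorem Forest.reduces_witnessNet {rs : List ℕ} {F : Forest} {i : ℕ} {Ms : List (Tm 0)}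
    (h : (Forest.run rs F).any (Forest.isWitnessNet i Ms) = true) :
    Forest.Reduces succTheory F (witnessNet i Ms) := by
  cases hG : Forest.run rs F with
  | none => rw [hG] at h; cases h
  | some G =>
    rw [hG] at h
    rw [← Forest.eq_witnessNet h]
    exact Forest.reduces_of_run hG

/-! ### Cut-free nets and confluence -/

/-- Each rule contracts a cut, and a cut can only be equal to a cut. -/
theorem Forest.not_step_of_cutFree {T : Set (QF 0)} {F G : Forest} (hF : Forest.CutFree F) :
    ¬ Forest.Step T F G := by
  rintro ⟨F', G', ⟨F'', hperm, hF''⟩, -, hrule, -⟩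
  obtain ⟨t, s, A, F₁, rfl⟩ : ∃ t s A F₁, F' = .cut t s A :: F₁ := by
    cases hrule with
    | prop => exact ⟨_, _, _, _, rfl⟩
    | comm => exact ⟨_, _, _, _, rfl⟩
    | dup _ _ _ _ _ _ _ _ _ _ h => exact ⟨_, _, _, _, h⟩
  obtain ⟨R, F₂, hR, -, rfl⟩ := List.forall₂_cons_right_iff.1 hF''
  have hmem : R ∈ F := hperm.symm.subset (List.mem_cons_self ..)
  cases hR with
  | cut _ _ _ => exact hF _ _ _ hmem
  | swap _ _ _ => exact hF _ _ _ hmem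

theorem Forest.Reduces.eq_of_cutFree {T : Set (QF 0)} {F G : Forest} (hF : Forest.CutFree F)
    (h : Forest.Reduces T F G) : G = F := by
  cases h.cases_head with
  | inl h => exact h.symm
  | inr h =>
    obtain ⟨F', h, -⟩ := h
    exact absurd h (Forest.not_step_of_cutFree hF)

/-- The number of summands. -/
def Wits.length : Wits → ℕ
  | .nil => 0
  | .cons _ _ ws => ws.length + 1

theorem Wits.Eqv.length_eq : {ws ws' : Wits} → Wits.Eqv ws ws' → ws.length = ws'.length
  | _, _, .nil => rfl
  | _, _, .cons _ _ h => congrArg (· + 1) h.length_eq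
  | _, _, .swap .. => rfl
  | _, _, .trans h h' => h.length_eq.trans h'.length_eq

theorem Wits.length_rename (τ : Renaming) : (ws : Wits) → (ws.rename τ).length = ws.length
  | .nil => by rw [Wits.rename]
  | .cons _ _ ws => by rw [Wits.rename, Wits.length, Wits.length, ws.length_rename τ]

/-- Renaming and reordering preserve the number of summands. -/
theorem length_eq_of_iso_witnessNet {i j : ℕ} {Ms Ns : List (Tm 0)}
    (h : Forest.Iso (witnessNet i Ms) (witnessNet j Ns)) : Ms.length = Ns.length := by
  have length_foldr : ∀ i (Ms : List (Tm 0)),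
      (Ms.foldr (fun M ws => Wits.cons M (.leaf {i}) ws) .nil).length = Ms.length := by
    intro i Ms
    induction Ms with
    | nil => rfl
    | cons M Ms ih => exact congrArg (· + 1) ih
  obtain ⟨ρ, θ, -, F', hperm, hF'⟩ := h
  rw [witnessNet, Forest.rename, List.map_singleton, List.singleton_perm] at hperm
  subst hperm
  obtain ⟨hR, -⟩ := List.forall₂_cons.1 hF'
  rw [Root.rename, Tree.rename] at hR
  rcases hR with ⟨-, ⟨-⟩ | ⟨-⟩ | hws⟩
  rw [← length_foldr i Ms, ← length_foldr j Ns, ← hws.length_eq, Wits.length_rename]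

theorem cutFree_witnessNet (i : ℕ) (Ms : List (Tm 0)) : Forest.CutFree (witnessNet i Ms) := by
  simp [Forest.CutFree, witnessNet]

/-! ### The two reductions of the example -/

/-- The first cut is duplicated first.  The list gives the positions of the contracted cuts. -/
theorem exampleNet_reduces_three :
    Forest.Reduces succTheory exampleNet (witnessNet 13 [num 0, num 1, num 2]) :=
  Forest.reduces_witnessNet
    (rs := [0, 1, 1, 1, 1, 1, 0, 0, 0, 1, 0, 0, 1, 1, 0, 0, 0, 1, 1, 0]) (by decide +kernel)

/-- The second cut is duplicated first.  The list gives the positions of the contracted cuts. -/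
theorem exampleNet_reduces_four :
    Forest.Reduces succTheory exampleNet (witnessNet 13 [num 0, num 1, num 2, num 3]) :=
  Forest.reduces_witnessNet
    (rs := [1, 1, 0, 1, 1, 0, 0, 0, 1, 1, 1, 0, 1, 0, 0, 0, 1, 0, 0, 0]) (by decide +kernel)

end HerbrandNet

theorem mainTheorem3 :
    HerbrandNet.Forest.IsHerbrandNet HerbrandNet.succTheory HerbrandNet.exampleNet ∧
    HerbrandNet.Forest.type HerbrandNet.exampleNet = {HerbrandNet.goal} ∧
    (∃ i j : ℕ, ∃ N₃ N₄ : HerbrandNet.Forest,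
      N₃ = HerbrandNet.witnessNet i
        [HerbrandNet.num 0, HerbrandNet.num 1, HerbrandNet.num 2] ∧
      N₄ = HerbrandNet.witnessNet j
        [HerbrandNet.num 0, HerbrandNet.num 1, HerbrandNet.num 2, HerbrandNet.num 3] ∧
      HerbrandNet.Forest.Reduces HerbrandNet.succTheory HerbrandNet.exampleNet N₃ ∧
      HerbrandNet.Forest.Reduces HerbrandNet.succTheory HerbrandNet.exampleNet N₄ ∧
      HerbrandNet.Forest.IsHerbrandNet HerbrandNet.succTheory N₃ ∧
      HerbrandNet.Forest.IsHerbrandNet HerbrandNet.succTheory N₄ ∧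
      HerbrandNet.Forest.CutFree N₃ ∧ HerbrandNet.Forest.CutFree N₄ ∧
      HerbrandNet.Forest.type N₃ = {HerbrandNet.goal} ∧
      HerbrandNet.Forest.type N₄ = {HerbrandNet.goal} ∧
      ¬ HerbrandNet.Forest.Iso N₃ N₄) ∧
    ¬ HerbrandNet.MinimalReductionConfluent HerbrandNet.succTheory := by
  have hnet : HerbrandNet.Forest.IsHerbrandNet HerbrandNet.succTheory HerbrandNet.exampleNet :=
    HerbrandNet.Forest.isHerbrandNet_of_test (by decide +kernel)
  have h₃ := HerbrandNet.exampleNet_reduces_three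
  have h₄ := HerbrandNet.exampleNet_reduces_four
  have hiso : ¬ HerbrandNet.Forest.Iso _ _ := fun h =>
    absurd (HerbrandNet.length_eq_of_iso_witnessNet (i := 13) (j := 13)
      (Ms := [HerbrandNet.num 0, HerbrandNet.num 1, HerbrandNet.num 2])
      (Ns := [HerbrandNet.num 0, HerbrandNet.num 1, HerbrandNet.num 2, HerbrandNet.num 3]) h)
      (by decide)
  refine ⟨hnet, rfl, ⟨13, 13, _, _, rfl, rfl, h₃, h₄,
    HerbrandNet.Forest.isHerbrandNet_of_test (by decide +kernel),
    HerbrandNet.Forest.isHerbrandNet_of_test (by decide +kernel),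
    HerbrandNet.cutFree_witnessNet _ _, HerbrandNet.cutFree_witnessNet _ _, rfl, rfl, hiso⟩, ?_⟩
  intro hconf
  obtain ⟨G, H, hG, hH, h⟩ := hconf _ _ _ hnet h₃ h₄
  rw [HerbrandNet.Forest.Reduces.eq_of_cutFree (HerbrandNet.cutFree_witnessNet _ _) hG,
    HerbrandNet.Forest.Reduces.eq_of_cutFree (HerbrandNet.cutFree_witnessNet _ _) hH] at h
  exact hiso h
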